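/- Let $\alpha<\beta$ be real numbers, $n$ a natural number, $P_\Delta=\{(t,\tau)\in[\alpha,\beta]^2:\tau\le t\}$, and let $AC_0^2=AC_0^2([\alpha,\beta],\mathbb R^n)$ be the space of absolutely continuous $x:[\alpha,\beta]\to\mathbb R^n$ with $x(\alpha)=0$ and $x'\in L^2([\alpha,\beta],\mathbb R^n)$, normed by $\|x\|^2=\int_\alpha^\beta|x'(t)|^2\,dt$. Let $v:P_\Delta\times\mathbb R^n\to\mathbb R^n$ satisfy (A1), (A2), and at least one of (A3), (A4): (A1) For a.e. $\tau\in[\alpha,\beta]$, the function $v(\cdot,\tau,\cdot)$ is continuous on $[\tau,\beta]\times\mathbb R^n$, and its partial derivatives $v_t$, $v_x$ and $v_{tx}=(v_t)_x$ exist and are continuous on $[\tau,\beta]\times\mathbb R^n$ (the $t$-derivatives being one-sided at the end points of $[\tau,\beta]$). (A2) Each $f\in\{v,v_t,v_x,v_{tx}\}$ is measurable in $\tau\in[\alpha,t]$ for every $t\in[\alpha,\beta]$ and $x\in\mathbb R^n$, and is locally bounded in $x$: for every $\rho>0$ there is $l_\rho>0$ such that for a.e. $\tau\in[\alpha,\beta]$,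 all $t\in[\tau,\beta]$ and all $|x|\le\rho$ one has $|f(t,\tau,x)|\le l_\rho$. (A3) $v(t,t,x)=0$ for all $t\in[\alpha,\beta]$ and $x\in\mathbb R^n$, and there are nonnegative $c_0,d_0\in L^2(P_\Delta)$ with $|v_t(t,\tau,x)|\le c_0(t,\tau)|x|+d_0(t,\tau)$ for a.e. $(t,\tau)\in P_\Delta$ and all $x\in\mathbb R^n$, and $\|c_0\|_{L^2(P_\Delta)}<\frac{\sqrt2}{2(\beta-\alpha)}$. (A4) There are nonnegative $c_1,d_1\in L^2([\alpha,\beta])$ and $c_2,d_2\in L^2(P_\Delta)$ with $|v(t,t,x)|\le c_1(t)|x|+d_1(t)$ for a.e. $t\in[\alpha,\beta]$ and all $x\in\mathbb R^n$, $|v_t(t,\tau,x)|\le c_2(t,\tau)|x|+d_2(t,\tau)$ for a.e. $(t,\tau)\in P_\Delta$ and all $x\in\mathbb R^n$, and $\|\tilde c\|_{L^2([\alpha,\beta])}<\frac12$, where $\tilde c(t)=(t-\alpha)^{1/2}c_1(t)+\frac1{\sqrt2}(\beta-\alpha)\left(\int_\alpha^t c_2^2(t,\tau)\,d\tau\right)^{1/2}$.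 Then for every $x\in AC_0^2$ and $t\in[\alpha,\beta]$ the function $\tau\mapsto v(t,\tau,x(\tau))$ is integrable on $[\alpha,t]$, and $$V(x)(t)=x(t)+\int_\alpha^t v(t,\tau,x(\tau))\,d\tau$$ defines an operator $V:AC_0^2\to AC_0^2$ which is a diffeomorphism: $V$ is bijective, and $V$ and $V^{-1}$ are Fréchet differentiable at every point. Moreover, for every $a\in AC_0^2$ the equation $x(t)+\int_\alpha^t v(t,\tau,x(\tau))\,d\tau=a(t)$, $t\in[\alpha,\beta]$, has a unique solution $x_a\in AC_0^2$, and the map $a\mapsto x_a$ from $AC_0^2$ to $AC_0^2$ is continuously Fréchet differentiable (in particular continuous). -/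

import Mathlib

open MeasureTheory Set

noncomputable section

/-- Extension by `0` to the whole line of a function on `[α, β]`. -/
def extendByZero {α β : ℝ} {n : ℕ} (x : Icc α β → EuclideanSpace ℝ (Fin n)) (t : ℝ) :
    EuclideanSpace ℝ (Fin n) := by
  classical exact if h : t ∈ Icc α β then x ⟨t, h⟩ else 0

theorem extendByZero_add {α β : ℝ} {n : ℕ} (x y : Icc α β → EuclideanSpace ℝ (Fin n)) :
    extendByZero (x + y) = extendByZero x + extendByZero y := by
  funext t
  by_cases h : t ∈ Icc α β <;> simp only [extendByZero, h, dif_pos, dif_neg, Pi.add_apply,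
    not_false_eq_true, add_zero]

theorem extendByZero_smul {α β : ℝ} {n : ℕ} (c : ℝ) (x : Icc α β → EuclideanSpace ℝ (Fin n)) :
    extendByZero (c • x) = c • extendByZero x := by
  funext t
  by_cases h : t ∈ Icc α β <;> simp only [extendByZero, h, dif_pos, dif_neg, Pi.smul_apply,
    not_false_eq_true, smul_zero]

theorem extendByZero_zero {α β : ℝ} {n : ℕ} :
    extendByZero (0 : Icc α β → EuclideanSpace ℝ (Fin n)) = 0 := by
  funext t
  by_cases h : t ∈ Icc α β <;> simp [extendByZero]

/-- The conditions defining `AC₀²([α, β], ℝⁿ)`: the function is absolutely continuous on `[α, β]`,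
vanishes at `α`, and its (almost everywhere defined) derivative is square integrable. -/
structure IsAC02 {α β : ℝ} {n : ℕ} (x : Icc α β → EuclideanSpace ℝ (Fin n)) : Prop where
  absCont : AbsolutelyContinuousOnInterval (extendByZero x) α β
  left_eq_zero : extendByZero x α = 0
  deriv_memLp : MemLp (deriv (extendByZero x)) 2 (volume.restrict (Icc α β))

theorem ae_differentiableAt_of_absCont {α β : ℝ} {n : ℕ} {f : ℝ → EuclideanSpace ℝ (Fin n)}
    (hf : AbsolutelyContinuousOnInterval f α β) :
    ∀ᵐ t ∂(volume.restrict (Icc α β)), DifferentiableAt ℝ f t := by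
  refine (ae_restrict_iff' measurableSet_Icc).2 ?_
  filter_upwards [hf.boundedVariationOn.ae_differentiableAt_of_mem_uIcc] with t ht hmem
  exact ht (Icc_subset_uIcc hmem)

theorem deriv_add_ae {α β : ℝ} {n : ℕ} {f g : ℝ → EuclideanSpace ℝ (Fin n)}
    (hf : AbsolutelyContinuousOnInterval f α β) (hg : AbsolutelyContinuousOnInterval g α β) :
    deriv (f + g) =ᵐ[volume.restrict (Icc α β)] deriv f + deriv g := by
  filter_upwards [ae_differentiableAt_of_absCont hf, ae_differentiableAt_of_absCont hg]
    with t h1 h2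
  simpa using deriv_add h1 h2

theorem deriv_smul_eq {n : ℕ} (c : ℝ) (f : ℝ → EuclideanSpace ℝ (Fin n)) :
    deriv (c • f) = c • deriv f := by
  funext t
  exact deriv_const_smul_field c f

/-- `AC₀²([α, β], ℝⁿ)` as a linear subspace of the space of all functions `[α, β] → ℝⁿ`. -/
def ac02Submodule (α β : ℝ) (n : ℕ) : Submodule ℝ (Icc α β → EuclideanSpace ℝ (Fin n)) where
  carrier := {x | IsAC02 x}
  zero_mem' := by
    refine ⟨?_, ?_, ?_⟩ <;> rw [extendByZero_zero]
    · exact (LipschitzWith.const (0 : EuclideanSpace ℝ (Fin n))).lipschitzOnWith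
        |>.absolutelyContinuousOnInterval
    · rfl
    · rw [deriv_zero]
      exact MemLp.zero
  add_mem' := by
    intro x y hx hy
    refine ⟨?_, ?_, ?_⟩ <;> rw [extendByZero_add]
    · exact hx.absCont.add hy.absCont
    · simp [hx.left_eq_zero, hy.left_eq_zero]
    · exact (memLp_congr_ae (deriv_add_ae hx.absCont hy.absCont)).2
        (hx.deriv_memLp.add hy.deriv_memLp)
  smul_mem' := by
    intro c x hx
    refine ⟨?_, ?_, ?_⟩ <;> rw [extendByZero_smul]
    · exact hx.absCont.const_smul c
    · simp [hx.left_eq_zero]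
    · rw [deriv_smul_eq]
      exact hx.deriv_memLp.const_smul c

/-- The space `AC₀²([α, β], ℝⁿ)`. -/
def AC02 (α β : ℝ) (n : ℕ) : Type := ↥(ac02Submodule α β n)

namespace AC02

instance instAddCommGroup (α β : ℝ) (n : ℕ) : AddCommGroup (AC02 α β n) :=
  inferInstanceAs (AddCommGroup ↥(ac02Submodule α β n))

instance instModule (α β : ℝ) (n : ℕ) : Module ℝ (AC02 α β n) :=
  inferInstanceAs (Module ℝ ↥(ac02Submodule α β n))

/-- An element `x` of `AC₀²` is written as a function `x t` of the real variable `t`; outside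
`[α, β]` its value is `0` by convention. -/
instance instCoeFun (α β : ℝ) (n : ℕ) :
    CoeFun (AC02 α β n) (fun _ => ℝ → EuclideanSpace ℝ (Fin n)) :=
  ⟨fun x => extendByZero x.1⟩

variable {α β : ℝ} {n : ℕ}

theorem ext_of_forall {x y : AC02 α β n} (h : ∀ t ∈ Icc α β, x t = y t) : x = y := by
  apply Subtype.ext
  funext t
  have := h t.1 t.2
  simpa [extendByZero] using this

theorem coe_add (x y : AC02 α β n) : ⇑(x + y) = ⇑x + ⇑y := extendByZero_add x.1 y.1

theorem coe_smul (c : ℝ) (x : AC02 α β n) : ⇑(c • x) = c • ⇑x := extendByZero_smul c x.1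

/-- The norm `‖x‖ = (∫_α^β |x'(t)|² dt)^{1/2}`. -/
instance instNorm (α β : ℝ) (n : ℕ) : Norm (AC02 α β n) :=
  ⟨fun x => √(∫ t in Icc α β, ‖deriv x t‖ ^ 2)⟩

theorem norm_def (x : AC02 α β n) : ‖x‖ = √(∫ t in Icc α β, ‖deriv x t‖ ^ 2) := rfl

/-- The derivative as an element of `L²`. -/
def derivLp (x : AC02 α β n) :
    Lp (EuclideanSpace ℝ (Fin n)) 2 (volume.restrict (Icc α β)) :=
  x.2.deriv_memLp.toLp

theorem norm_eq_norm_derivLp (x : AC02 α β n) : ‖x‖ = ‖derivLp x‖ := by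
  rw [norm_def, derivLp, Lp.norm_toLp, x.2.deriv_memLp.eLpNorm_eq_integral_rpow_norm (by norm_num)
    (by norm_num), ENNReal.toReal_ofReal (by positivity), Real.sqrt_eq_rpow]
  norm_num

theorem derivLp_add (x y : AC02 α β n) : derivLp (x + y) = derivLp x + derivLp y := by
  rw [derivLp, derivLp, derivLp, ← MemLp.toLp_add, MemLp.toLp_eq_toLp_iff]
  have h := deriv_add_ae x.2.absCont y.2.absCont
  rw [← extendByZero_add] at h
  exact h

theorem derivLp_smul (c : ℝ) (x : AC02 α β n) : derivLp (c • x) = c • derivLp x := by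
  rw [derivLp, derivLp, ← MemLp.toLp_const_smul, MemLp.toLp_eq_toLp_iff]
  have h := deriv_smul_eq c (extendByZero x.1)
  rw [← extendByZero_smul] at h
  exact Filter.EventuallyEq.of_eq h

theorem eq_zero_of_derivLp_eq_zero (x : AC02 α β n) (h : derivLp x = 0) : x = 0 := by
  have h : deriv (extendByZero x.1) =ᵐ[volume.restrict (Icc α β)] 0 := by
    rw [derivLp, Lp.eq_zero_iff_ae_eq_zero] at h
    exact x.2.deriv_memLp.coeFn_toLp.symm.trans h
  apply ext_of_forall
  intro t ht
  have hab : α ≤ β := ht.1.trans ht.2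
  have h0 : ∀ᵐ s, s ∈ uIcc α β → HasDerivAt (⇑x) 0 s := by
    rw [uIcc_of_le hab, ← ae_restrict_iff' measurableSet_Icc]
    filter_upwards [h, ae_differentiableAt_of_absCont x.2.absCont] with s h1 h2
    have h3 := h2.hasDerivAt
    rw [h1] at h3
    exact h3
  obtain ⟨C, hC⟩ := x.2.absCont.const_of_ae_hasDerivAt_zero h0
  rw [uIcc_of_le hab] at hC
  have h1 : x t = C := hC t ht
  have h2 : x α = C := hC α ⟨le_rfl, hab⟩
  have h3 : x α = 0 := x.2.left_eq_zero
  have h4 : (⇑(0 : AC02 α β n)) t = 0 := congrFun extendByZero_zero t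
  rw [h1, h4, ← h2, h3]

theorem normedSpaceCore (α β : ℝ) (n : ℕ) : NormedSpace.Core ℝ (AC02 α β n) where
  norm_nonneg x := Real.sqrt_nonneg _
  norm_smul c x := by rw [norm_eq_norm_derivLp, norm_eq_norm_derivLp, derivLp_smul, norm_smul]
  norm_triangle x y := by
    rw [norm_eq_norm_derivLp, norm_eq_norm_derivLp, norm_eq_norm_derivLp, derivLp_add]
    exact norm_add_le _ _
  norm_eq_zero_iff x := by
    rw [norm_eq_norm_derivLp, norm_eq_zero]
    refine ⟨eq_zero_of_derivLp_eq_zero x, ?_⟩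
    rintro rfl
    have h := derivLp_smul (0 : ℝ) (0 : AC02 α β n)
    rwa [zero_smul, zero_smul] at h

instance instNormedAddCommGroup (α β : ℝ) (n : ℕ) : NormedAddCommGroup (AC02 α β n) :=
  NormedAddCommGroup.ofCore (normedSpaceCore α β n)

instance instNormedSpace (α β : ℝ) (n : ℕ) : NormedSpace ℝ (AC02 α β n) :=
  NormedSpace.ofCore (normedSpaceCore α β n)

end AC02

/-- The triangle `P_Δ = {(t, τ) ∈ [α, β]² : τ ≤ t}`. -/
def triangle (α β : ℝ) : Set (ℝ × ℝ) :=
  {p | p.1 ∈ Icc α β ∧ p.2 ∈ Icc α β ∧ p.2 ≤ p.1}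

/-- The partial derivative `v_t(t, τ, x)`; as `v(·, τ, x)` lives on `[τ, β]`, it is one-sided at
the end points. -/
def vt {n : ℕ} (β : ℝ) (v : ℝ → ℝ → EuclideanSpace ℝ (Fin n) → EuclideanSpace ℝ (Fin n))
    (t τ : ℝ) (x : EuclideanSpace ℝ (Fin n)) : EuclideanSpace ℝ (Fin n) :=
  derivWithin (fun s => v s τ x) (Icc τ β) t

/-- The partial derivative `v_x(t, τ, x)`, an endomorphism of `ℝⁿ`. -/
def vx {n : ℕ} (v : ℝ → ℝ → EuclideanSpace ℝ (Fin n) → EuclideanSpace ℝ (Fin n))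
    (t τ : ℝ) (x : EuclideanSpace ℝ (Fin n)) :
    EuclideanSpace ℝ (Fin n) →L[ℝ] EuclideanSpace ℝ (Fin n) :=
  fderiv ℝ (fun y => v t τ y) x

/-- The mixed derivative `v_tx(t, τ, x)`, the `x`-derivative of `v_t`. -/
def vtx {n : ℕ} (β : ℝ) (v : ℝ → ℝ → EuclideanSpace ℝ (Fin n) → EuclideanSpace ℝ (Fin n))
    (t τ : ℝ) (x : EuclideanSpace ℝ (Fin n)) :
    EuclideanSpace ℝ (Fin n) →L[ℝ] EuclideanSpace ℝ (Fin n) :=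
  fderiv ℝ (fun y => vt β v t τ y) x

/-- Condition (A1): for a.e. `τ`, the function `v(·, τ, ·)` and its derivatives `v_t`, `v_x`, `v_tx`
exist and are continuous on `[τ, β] × ℝⁿ`. -/
structure ConditionA1 {n : ℕ} (α β : ℝ)
    (v : ℝ → ℝ → EuclideanSpace ℝ (Fin n) → EuclideanSpace ℝ (Fin n)) : Prop where
  a : ∀ᵐ τ ∂(volume.restrict (Icc α β)),
    ContinuousOn (fun p : ℝ × EuclideanSpace ℝ (Fin n) => v p.1 τ p.2) (Icc τ β ×ˢ univ)
  b : ∀ᵐ τ ∂(volume.restrict (Icc α β)),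
    (∀ t ∈ Icc τ β, ∀ x, DifferentiableWithinAt ℝ (fun s => v s τ x) (Icc τ β) t) ∧
    ContinuousOn (fun p : ℝ × EuclideanSpace ℝ (Fin n) => vt β v p.1 τ p.2) (Icc τ β ×ˢ univ)
  c : ∀ᵐ τ ∂(volume.restrict (Icc α β)),
    (∀ t ∈ Icc τ β, ∀ x, DifferentiableAt ℝ (fun y => v t τ y) x) ∧
    ContinuousOn (fun p : ℝ × EuclideanSpace ℝ (Fin n) => vx v p.1 τ p.2) (Icc τ β ×ˢ univ)
  d : ∀ᵐ τ ∂(volume.restrict (Icc α β)),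
    (∀ t ∈ Icc τ β, ∀ x, DifferentiableAt ℝ (fun y => vt β v t τ y) x) ∧
    ContinuousOn (fun p : ℝ × EuclideanSpace ℝ (Fin n) => vtx β v p.1 τ p.2) (Icc τ β ×ˢ univ)

/-- `f(t, τ, x)` is (Lebesgue) measurable with respect to `τ` and locally bounded with respect to
`x`, uniformly in `t ∈ [τ, β]` and almost every `τ ∈ [α, β]`. -/
structure MeasurableLocallyBounded {n : ℕ} {F : Type*} [NormedAddCommGroup F] (α β : ℝ)
    (f : ℝ → ℝ → EuclideanSpace ℝ (Fin n) → F) : Prop where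
  measurable : ∀ t ∈ Icc α β, ∀ x,
    AEStronglyMeasurable (fun τ => f t τ x) (volume.restrict (Icc α t))
  bounded : ∀ ρ > 0, ∃ l > 0, ∀ᵐ τ ∂(volume.restrict (Icc α β)), ∀ t ∈ Icc τ β,
    ∀ x, ‖x‖ ≤ ρ → ‖f t τ x‖ ≤ l

/-- Condition (A2): `v`, `v_t`, `v_x` and `v_tx` are measurable with respect to `τ` and locally
bounded with respect to `x`. -/
structure ConditionA2 {n : ℕ} (α β : ℝ)
    (v : ℝ → ℝ → EuclideanSpace ℝ (Fin n) → EuclideanSpace ℝ (Fin n)) : Prop where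
  a : MeasurableLocallyBounded α β v
  b : MeasurableLocallyBounded α β (vt β v)
  c : MeasurableLocallyBounded α β (vx v)
  d : MeasurableLocallyBounded α β (vtx β v)

/-- `c` belongs to `L²(P_Δ, ℝ⁺)`. -/
def IsL2Triangle (α β : ℝ) (c : ℝ × ℝ → ℝ) : Prop :=
  (∀ p ∈ triangle α β, 0 ≤ c p) ∧ MemLp c 2 (volume.restrict (triangle α β))

/-- Linear growth of `v_t`: `|v_t(t, τ, x)| ≤ c(t, τ) |x| + d(t, τ)` on `P_Δ`. -/
def LinearGrowthVt {n : ℕ} (α β : ℝ)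
    (v : ℝ → ℝ → EuclideanSpace ℝ (Fin n) → EuclideanSpace ℝ (Fin n)) (c d : ℝ × ℝ → ℝ) : Prop :=
  ∀ᵐ p ∂(volume.restrict (triangle α β)), ∀ x, ‖vt β v p.1 p.2 x‖ ≤ c p * ‖x‖ + d p

/-- Condition (A3): `v` vanishes on the diagonal and `v_t` has small linear growth. -/
def ConditionA3 {n : ℕ} (α β : ℝ)
    (v : ℝ → ℝ → EuclideanSpace ℝ (Fin n) → EuclideanSpace ℝ (Fin n)) : Prop :=
  (∀ t ∈ Icc α β, ∀ x, v t t x = 0) ∧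
  ∃ c₀ d₀ : ℝ × ℝ → ℝ, IsL2Triangle α β c₀ ∧ IsL2Triangle α β d₀ ∧
    LinearGrowthVt α β v c₀ d₀ ∧
    eLpNorm c₀ 2 (volume.restrict (triangle α β)) < ENNReal.ofReal (√2 / (2 * (β - α)))

/-- Condition (A4): linear growth of `v` on the diagonal and of `v_t`, with a smallness condition
on the coefficients. -/
def ConditionA4 {n : ℕ} (α β : ℝ)
    (v : ℝ → ℝ → EuclideanSpace ℝ (Fin n) → EuclideanSpace ℝ (Fin n)) : Prop :=
  ∃ (c₁ d₁ : ℝ → ℝ) (c₂ d₂ : ℝ × ℝ → ℝ),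
    (∀ t ∈ Icc α β, 0 ≤ c₁ t ∧ 0 ≤ d₁ t) ∧
    MemLp c₁ 2 (volume.restrict (Icc α β)) ∧ MemLp d₁ 2 (volume.restrict (Icc α β)) ∧
    (∀ᵐ t ∂(volume.restrict (Icc α β)), ∀ x, ‖v t t x‖ ≤ c₁ t * ‖x‖ + d₁ t) ∧
    IsL2Triangle α β c₂ ∧ IsL2Triangle α β d₂ ∧ LinearGrowthVt α β v c₂ d₂ ∧
    eLpNorm (fun t => √(t - α) * c₁ t + 1 / √2 * (β - α) * √(∫ τ in α..t, c₂ (t, τ) ^ 2)) 2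
      (volume.restrict (Icc α β)) < ENNReal.ofReal (1 / 2)

/-- The right-hand side `x(t) + ∫_α^t v(t, τ, x(τ)) dτ` of the Volterra operator. -/
def volterra {n : ℕ} (α : ℝ) (v : ℝ → ℝ → EuclideanSpace ℝ (Fin n) → EuclideanSpace ℝ (Fin n))
    (x : ℝ → EuclideanSpace ℝ (Fin n)) (t : ℝ) : EuclideanSpace ℝ (Fin n) :=
  x t + ∫ τ in α..t, v t τ (x τ)

/-- A diffeomorphism of a normed space onto itself: a bijection that is Fréchet differentiable at
every point together with its inverse. -/
def IsDiffeomorphism {X : Type*} [NormedAddCommGroup X] [NormedSpace ℝ X] (V : X → X) : Prop :=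
  ∃ W : X → X, Function.LeftInverse W V ∧ Function.RightInverse W V ∧
    Differentiable ℝ V ∧ Differentiable ℝ W

end

/-!
Let `E` be the space of continuous functions on `[α, β]` and `K(x)(t) = ∫_α^t v(t, τ, x(τ)) dτ`, so
that the operator in question is `V = 1 + K`. The proof works in `E` as far as possible, because `K`
maps `E` into `AC₀²`, so that solving `x + K(x) = a` in `E` for `a ∈ AC₀²` already gives
`x = a - K(x) ∈ AC₀²`.

`K : E → AC₀²` is of class `C¹`. By Fubini and the fundamental theorem of calculus
(`integral_diagonal_add_triangle`), `K(x)` is the primitive of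
`v(t, t, x(t)) + ∫_α^t v_t(t, τ, x(τ)) dτ`. Hence `K` is a composition of superposition operators
`E → L²` with the bounded linear maps `integrateSecond` and `AC02.primitive`, and a superposition
operator with a `C¹`, locally bounded integrand is `C¹` from `E` to `L²` by dominated convergence
(`IsC1Integrand.contDiff_nemytskii`). The measurability needed for this is
`aestronglyMeasurable_superposition`.

`1 + K` is a `C¹` diffeomorphism of `E` onto an open set. Since `v` is Lipschitz in `x` on balls,
`|K(x)(t) - K(y)(t)| ≤ L ∫_α^t |x - y|` (`IsLocallyVolterra`). Grönwall's inequality then gives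
injectivity and a Lipschitz bound for the inverse on bounded sets. The derivative of `K` satisfies
the same estimate, so its `k`-th power has norm at most `(L (β - α))^k / k!`, a Neumann series shows
that `1 + K'(x)` is invertible, and the inverse function theorem applies
(`IsLocallyVolterra.isOpen_range_and_contDiffAt`).

Every `a ∈ AC₀²` is attained. Under (A4), of which (A3) is the special case `c₁ = d₁ = 0`, the bound
`|x(t)| ≤ (t - α)^{1/2} ‖x‖` and the Cauchy–Schwarz inequality give `‖K(x)‖ ≤ q ‖x‖ + D` on `AC₀²`
with `q < 1`, hence an a priori bound for solutions (`exists_apriori_bound`). With the Lipschitz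
bound for the inverse it follows that the set of attained `a` is closed in `AC₀²`; it is open and
nonempty, hence everything (`toContinuous_mem_range`). Finally `V⁻¹(a) = a - K((1 + K)⁻¹(a))` is
`C¹` as a composition of `C¹` maps.
-/

open Filter Topology

noncomputable section

/-! ### Measurability of superpositions with a kernel of Carathéodory type -/

/-- A function glued from countably many a.e. measurable pieces along a measurable index map is
a.e. measurable. -/
theorem aestronglyMeasurable_of_countable_index {Ω I F : Type*} [MeasurableSpace Ω]
    {ν : Measure Ω} [NormedAddCommGroup F] [Countable I]
    (s : I → Set Ω) (hs : ∀ i, MeasurableSet (s i)) (hcov : ⋃ i, s i = univ) {H : Ω → F}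
    (F' : I → Ω → F) (hF : ∀ i, AEStronglyMeasurable (F' i) (ν.restrict (s i)))
    (heq : ∀ i, ∀ ω ∈ s i, H ω = F' i ω) :
    AEStronglyMeasurable H ν := by
  rw [← Measure.restrict_univ (μ := ν), ← hcov, aestronglyMeasurable_iUnion_iff]
  intro i
  refine (hF i).congr ?_
  filter_upwards [ae_restrict_mem (hs i)] with ω hω
  exact (heq i ω hω).symm

/-- The point `α + z / (m + 1)` of the grid of step `1 / (m + 1)`, clamped to `[α, β]`. -/
def gridPoint (α β : ℝ) (m : ℕ) (z : ℤ) : ℝ := max α (min β (α + z / (m + 1)))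

theorem gridPoint_mem {α β : ℝ} (h : α ≤ β) (m : ℕ) (z : ℤ) : gridPoint α β m z ∈ Icc α β :=
  ⟨le_max_left _ _, max_le h (min_le_left _ _)⟩

theorem le_gridPoint_ceil {α β t : ℝ} (ht : t ∈ Icc α β) (m : ℕ) :
    t ≤ gridPoint α β m ⌈(t - α) * (m + 1)⌉ := by
  refine le_max_of_le_right (le_min ht.2 ?_)
  have hm : (0 : ℝ) < m + 1 := by positivity
  have := Int.le_ceil ((t - α) * (m + 1))
  rw [← le_div_iff₀ hm] at this
  linarith

theorem gridPoint_ceil_le {α β t : ℝ} (ht : t ∈ Icc α β) (m : ℕ) :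
    gridPoint α β m ⌈(t - α) * (m + 1)⌉ ≤ t + 1 / ((m : ℝ) + 1) := by
  have hm : (0 : ℝ) < m + 1 := by positivity
  have h1 : (0 : ℝ) ≤ 1 / (m + 1) := by positivity
  refine max_le (by linarith [ht.1]) ((min_le_right _ _).trans ?_)
  have := (Int.ceil_lt_add_one ((t - α) * (m + 1))).le
  have h2 := div_le_div_of_nonneg_right this hm.le
  rw [add_div, mul_div_cancel_right₀ _ hm.ne'] at h2
  linarith

theorem tendsto_gridPoint_ceil {α β t : ℝ} (ht : t ∈ Icc α β) :
    Tendsto (fun m : ℕ => gridPoint α β m ⌈(t - α) * (m + 1)⌉) atTop (𝓝 t) := by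
  refine tendsto_of_tendsto_of_tendsto_of_le_of_le tendsto_const_nhds ?_
    (fun m => le_gridPoint_ceil ht m) (fun m => gridPoint_ceil_le ht m)
  simpa using (tendsto_const_nhds (x := t)).add
    (tendsto_one_div_add_atTop_nhds_zero_nat (𝕜 := ℝ))

/-- Superposition of a kernel of Carathéodory type on the triangle. The arguments `t` and `x` are
replaced by countably valued approximations, `t` from the right, so that the kernel is only
evaluated at points with `τ ≤ t`. -/
theorem aestronglyMeasurable_superposition {Ω G F : Type*} [MeasurableSpace Ω] {ν : Measure Ω}
    [NormedAddCommGroup G] [NormedAddCommGroup F] {α β : ℝ} (hαβ : α ≤ β) {f : ℝ → ℝ → G → F}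
    (hc : ∀ᵐ τ ∂(volume.restrict (Icc α β)),
      ContinuousOn (fun p : ℝ × G => f p.1 τ p.2) (Icc τ β ×ˢ univ))
    (hm : ∀ t ∈ Icc α β, ∀ x,
      AEStronglyMeasurable (fun τ => f t τ x) (volume.restrict (Icc α t)))
    {θ σ : Ω → ℝ} {ξ : Ω → G} (hθ : Measurable θ)
    (hσ : Measure.QuasiMeasurePreserving σ ν (volume.restrict (Icc α β)))
    (hξ : StronglyMeasurable ξ) (hmem : ∀ᵐ ω ∂ν, α ≤ σ ω ∧ σ ω ≤ θ ω ∧ θ ω ≤ β) :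
    AEStronglyMeasurable (fun ω => f (θ ω) (σ ω) (ξ ω)) ν := by
  let g : ℕ → Ω → F := fun m ω =>
    f (gridPoint α β m ⌈(θ ω - α) * (m + 1)⌉) (σ ω) (hξ.approx m ω)
  refine aestronglyMeasurable_of_tendsto_ae atTop (f := g) ?_ ?_
  · intro m
    let s : ℤ × (hξ.approx m).range → Set Ω := fun i =>
      {ω | ⌈(θ ω - α) * (m + 1)⌉ = i.1} ∩ (hξ.approx m) ⁻¹' {i.2.1}
    have hs : ∀ i, MeasurableSet (s i) := fun i =>
      ((Int.measurable_ceil.comp ((hθ.sub_const α).mul_const _))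
        (measurableSet_singleton i.1)).inter ((hξ.approx m).measurableSet_preimage _)
    refine aestronglyMeasurable_of_countable_index s hs ?_
      (fun i ω => f (gridPoint α β m i.1) (σ ω) i.2.1) ?_ ?_
    · refine eq_univ_of_forall fun ω => mem_iUnion.2
        ⟨(⌈(θ ω - α) * (m + 1)⌉, ⟨hξ.approx m ω, SimpleFunc.mem_range_self _ _⟩), rfl, rfl⟩
    · intro i
      -- On this piece `σ ≤ θ ≤ gridPoint`, which is where the kernel is measurable in `τ`.
      have hq : Measure.QuasiMeasurePreserving σ (ν.restrict (s i))
          (volume.restrict (Icc α (gridPoint α β m i.1))) := by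
        refine ⟨hσ.measurable, ?_⟩
        refine Measure.AbsolutelyContinuous.mk fun N hN hN0 => ?_
        rw [Measure.map_apply hσ.measurable hN]
        rw [Measure.restrict_apply hN] at hN0
        have hNβ : (volume.restrict (Icc α β)) (N ∩ Icc α (gridPoint α β m i.1)) = 0 :=
          le_antisymm ((Measure.restrict_apply_le _ _).trans hN0.le) zero_le
        have h0 := hσ.preimage_null hNβ
        rw [Measure.restrict_apply (hσ.measurable hN)]
        refine measure_mono_null_ae ?_ h0
        filter_upwards [hmem] with ω hω hω'
        refine ⟨hω'.1, hω.1, hω.2.1.trans ?_⟩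
        have : ⌈(θ ω - α) * (m + 1)⌉ = i.1 := hω'.2.1
        rw [← this]
        exact le_gridPoint_ceil ⟨hω.1.trans hω.2.1, hω.2.2⟩ m
      exact (hm _ (gridPoint_mem hαβ m i.1) i.2.1).comp_quasiMeasurePreserving hq
    · rintro i ω ⟨h1, h2⟩
      simp only [mem_ofPred_eq] at h1
      simp only [mem_preimage, mem_singleton_iff] at h2
      simp only [g, h1, h2]
  · filter_upwards [hσ.ae hc, hmem] with ω hcω hω
    have ht : θ ω ∈ Icc α β := ⟨hω.1.trans hω.2.1, hω.2.2⟩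
    have h1 : ContinuousWithinAt (fun p : ℝ × G => f p.1 (σ ω) p.2) (Icc (σ ω) β ×ˢ univ)
        (θ ω, ξ ω) := hcω _ ⟨⟨hω.2.1, hω.2.2⟩, mem_univ _⟩
    have h2 : Tendsto (fun m : ℕ => (gridPoint α β m ⌈(θ ω - α) * (m + 1)⌉, hξ.approx m ω))
        atTop (𝓝[Icc (σ ω) β ×ˢ univ] (θ ω, ξ ω)) := by
      refine tendsto_nhdsWithin_iff.2
        ⟨(tendsto_gridPoint_ceil ht).prodMk_nhds (hξ.tendsto_approx ω), ?_⟩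
      refine Eventually.of_forall fun m => ⟨⟨?_, (gridPoint_mem hαβ _ _).2⟩, mem_univ _⟩
      exact hω.2.1.trans (le_gridPoint_ceil ht m)
    exact h1.tendsto.comp h2

/-! ### Superposition operators from continuous functions to `L²` -/

/-- Bounded convergence in `L²` of a finite measure space. -/
theorem tendsto_eLpNorm_two_zero {Ω F ι : Type*} [MeasurableSpace Ω] {ν : Measure Ω}
    [IsFiniteMeasure ν] [NormedAddCommGroup F] {l : Filter ι} [l.IsCountablyGenerated]
    {Φ : ι → Ω → F} (hm : ∀ i, AEStronglyMeasurable (Φ i) ν) {C : ℝ}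
    (hb : ∀ᶠ i in l, ∀ᵐ ω ∂ν, ‖Φ i ω‖ ≤ C)
    (hl : ∀ᵐ ω ∂ν, Tendsto (fun i => Φ i ω) l (𝓝 0)) :
    Tendsto (fun i => eLpNorm (Φ i) 2 ν) l (𝓝 0) := by
  have key : Tendsto (fun i => ∫⁻ ω, ‖Φ i ω‖ₑ ^ (2 : ℝ) ∂ν) l (𝓝 (∫⁻ _, 0 ∂ν)) := by
    refine tendsto_lintegral_filter_of_dominated_convergence' (fun _ => ENNReal.ofReal C ^ (2 : ℝ))
      (Eventually.of_forall fun i => (hm i).enorm.pow_const _) ?_ ?_ ?_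
    · filter_upwards [hb] with i hi
      filter_upwards [hi] with ω hω
      gcongr
      rw [← ofReal_norm]
      exact ENNReal.ofReal_le_ofReal hω
    · rw [lintegral_const]
      exact ENNReal.mul_ne_top (by simp) (measure_ne_top _ _)
    · filter_upwards [hl] with ω hω
      have := (hω.enorm).ennrpow_const (2 : ℝ)
      simpa using this
  have := key.ennrpow_const (1 / 2 : ℝ)
  simpa [eLpNorm_eq_lintegral_rpow_enorm_toReal] using this

/-- The integrand `g` of a superposition operator `x ↦ (ω ↦ g(ω, x(σ ω)))` on continuous functions
`x : T → G` that is continuously differentiable in the second variable with derivative `g'`, both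
being locally bounded uniformly in `ω`. -/
structure IsC1Integrand {Ω T G F : Type*} [MeasurableSpace Ω] [TopologicalSpace T]
    [NormedAddCommGroup G] [NormedSpace ℝ G] [NormedAddCommGroup F] [NormedSpace ℝ F]
    (ν : Measure Ω) (σ : Ω → T) (g : Ω → G → F) (g' : Ω → G → G →L[ℝ] F) : Prop where
  meas : ∀ x : C(T, G), AEStronglyMeasurable (fun ω => g ω (x (σ ω))) ν
  meas_deriv : ∀ x : C(T, G), AEStronglyMeasurable (fun ω => g' ω (x (σ ω))) ν
  hasFDerivAt : ∀ᵐ ω ∂ν, ∀ y, HasFDerivAt (g ω) (g' ω y) y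
  continuous_deriv : ∀ᵐ ω ∂ν, Continuous (g' ω)
  bounded : ∀ ρ : ℝ, ∃ l : ℝ, ∀ᵐ ω ∂ν, ∀ y, ‖y‖ ≤ ρ → ‖g ω y‖ ≤ l ∧ ‖g' ω y‖ ≤ l

namespace IsC1Integrand

set_option linter.unusedSectionVars false

variable {Ω T G F : Type*} [MeasurableSpace Ω] [TopologicalSpace T] [CompactSpace T]
  [MeasurableSpace T] [BorelSpace T] [NormedAddCommGroup G] [NormedSpace ℝ G]
  [SecondCountableTopology G] [NormedAddCommGroup F] [NormedSpace ℝ F]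
  {ν : Measure Ω} [IsFiniteMeasure ν] {σ : Ω → T} {g : Ω → G → F} {g' : Ω → G → G →L[ℝ] F}

theorem memLp (hg : IsC1Integrand ν σ g g') (x : C(T, G)) :
    MemLp (fun ω => g ω (x (σ ω))) 2 ν := by
  obtain ⟨l, hl⟩ := hg.bounded ‖x‖
  refine MemLp.of_bound (hg.meas x) l ?_
  filter_upwards [hl] with ω hω
  exact (hω _ (x.norm_coe_le_norm _)).1

theorem ae_norm_deriv_apply_le (hg : IsC1Integrand ν σ g g') (ρ : ℝ) :
    ∃ l, 0 ≤ l ∧ ∀ x : C(T, G), ‖x‖ ≤ ρ → ∀ᵐ ω ∂ν, ‖g' ω (x (σ ω))‖ ≤ l := by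
  obtain ⟨l, hl⟩ := hg.bounded ρ
  refine ⟨max l 0, le_max_right _ _, fun x hx => ?_⟩
  filter_upwards [hl] with ω hω
  exact (hω _ ((x.norm_coe_le_norm _).trans hx)).2.trans (le_max_left _ _)

theorem aestronglyMeasurable_comp (hσ : Measurable σ) (h : C(T, G)) :
    AEStronglyMeasurable (fun ω => h (σ ω)) ν :=
  (h.continuous.stronglyMeasurable.comp_measurable hσ).aestronglyMeasurable

theorem aestronglyMeasurable_deriv_apply (hg : IsC1Integrand ν σ g g') (hσ : Measurable σ)
    (x h : C(T, G)) : AEStronglyMeasurable (fun ω => g' ω (x (σ ω)) (h (σ ω))) ν :=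
  (ContinuousLinearMap.id ℝ (G →L[ℝ] F)).aestronglyMeasurable_comp₂ (hg.meas_deriv x)
    (aestronglyMeasurable_comp hσ h)

theorem memLp_deriv (hg : IsC1Integrand ν σ g g') (hσ : Measurable σ) (x h : C(T, G)) :
    MemLp (fun ω => g' ω (x (σ ω)) (h (σ ω))) 2 ν := by
  obtain ⟨l, hl0, hl⟩ := hg.ae_norm_deriv_apply_le ‖x‖
  refine MemLp.of_bound (hg.aestronglyMeasurable_deriv_apply hσ x h) (l * ‖h‖) ?_
  filter_upwards [hl x le_rfl] with ω hω
  exact (ContinuousLinearMap.le_opNorm _ _).trans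
    (mul_le_mul hω (h.norm_coe_le_norm _) (norm_nonneg _) hl0)

/-- The superposition operator `x ↦ (ω ↦ g(ω, x(σ ω)))` from continuous functions to `L²`. -/
def nemytskii (hg : IsC1Integrand ν σ g g') (x : C(T, G)) : Lp F 2 ν := (hg.memLp x).toLp

theorem nemytskii_ae_eq (hg : IsC1Integrand ν σ g g') (x : C(T, G)) :
    hg.nemytskii x =ᵐ[ν] fun ω => g ω (x (σ ω)) := (hg.memLp x).coeFn_toLp

/-- The derivative of the superposition operator, `h ↦ (ω ↦ g'(ω, x(σ ω)) h(σ ω))`. -/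
def nemytskiiDeriv (hg : IsC1Integrand ν σ g g') (hσ : Measurable σ) (x : C(T, G)) :
    C(T, G) →L[ℝ] Lp F 2 ν :=
  LinearMap.mkContinuousOfExistsBound
    { toFun := fun h => (hg.memLp_deriv hσ x h).toLp
      map_add' := fun h k => by
        rw [← MemLp.toLp_add, MemLp.toLp_eq_toLp_iff]
        exact Eventually.of_forall fun ω => by simp
      map_smul' := fun c h => by
        rw [RingHom.id_apply, ← MemLp.toLp_const_smul, MemLp.toLp_eq_toLp_iff]
        exact Eventually.of_forall fun ω => by simp }
    (by
      obtain ⟨l, hl0, hl⟩ := hg.ae_norm_deriv_apply_le ‖x‖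
      refine ⟨(measureUnivNNReal ν : ℝ) ^ (ENNReal.toReal 2)⁻¹ * l, fun h => ?_⟩
      have h1 := Lp.norm_le_of_ae_bound (f := (hg.memLp_deriv hσ x h).toLp) (C := l * ‖h‖)
        (by positivity) (by
          filter_upwards [hl x le_rfl, (hg.memLp_deriv hσ x h).coeFn_toLp] with ω hω he
          rw [he]
          exact (ContinuousLinearMap.le_opNorm _ _).trans
            (mul_le_mul hω (h.norm_coe_le_norm _) (norm_nonneg _) hl0))
      exact h1.trans_eq (mul_assoc _ _ _).symm)

theorem nemytskiiDeriv_apply (hg : IsC1Integrand ν σ g g') (hσ : Measurable σ) (x h : C(T, G)) :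
    hg.nemytskiiDeriv hσ x h = (hg.memLp_deriv hσ x h).toLp := rfl

theorem hasFDerivAt_nemytskii (hg : IsC1Integrand ν σ g g') (hσ : Measurable σ) (x : C(T, G)) :
    HasFDerivAt hg.nemytskii (hg.nemytskiiDeriv hσ x) x := by
  rw [hasFDerivAt_iff_tendsto]
  let Φ : C(T, G) → Ω → F := fun y ω => ‖y - x‖⁻¹ •
    (g ω (y (σ ω)) - g ω (x (σ ω)) - g' ω (x (σ ω)) ((y - x) (σ ω)))
  have hΦ : ∀ y, MemLp (Φ y) 2 ν := fun y =>
    (((hg.memLp y).sub (hg.memLp x)).sub (hg.memLp_deriv hσ x (y - x))).const_smul _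
  have hnorm : ∀ y, ‖y - x‖⁻¹ * ‖hg.nemytskii y - hg.nemytskii x
      - hg.nemytskiiDeriv hσ x (y - x)‖ = (eLpNorm (Φ y) 2 ν).toReal := by
    intro y
    rw [nemytskii, nemytskii, nemytskiiDeriv_apply, ← MemLp.toLp_sub, ← MemLp.toLp_sub,
      ← Lp.norm_toLp _ (hΦ y), ← Real.norm_of_nonneg (inv_nonneg.2 (norm_nonneg (y - x))),
      ← norm_smul, ← MemLp.toLp_const_smul]
    rfl
  simp_rw [hnorm]
  rw [← ENNReal.toReal_zero]
  refine (ENNReal.tendsto_toReal ENNReal.zero_ne_top).comp ?_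
  obtain ⟨l, hl⟩ := hg.bounded (‖x‖ + 1)
  refine tendsto_eLpNorm_two_zero (fun y => (hΦ y).1) (C := 2 * max l 0) ?_ ?_
  · -- By the mean value inequality, `g` is Lipschitz on the ball of radius `‖x‖ + 1`.
    filter_upwards [Metric.closedBall_mem_nhds x one_pos] with y hy
    rw [Metric.mem_closedBall, dist_eq_norm] at hy
    have hyρ : ‖y‖ ≤ ‖x‖ + 1 := by
      have := norm_add_le x (y - x)
      rw [add_sub_cancel] at this
      linarith
    filter_upwards [hl, hg.hasFDerivAt] with ω hω hd
    have hlip : ‖g ω (y (σ ω)) - g ω (x (σ ω))‖ ≤ max l 0 * ‖y (σ ω) - x (σ ω)‖ :=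
      (convex_closedBall (0 : G) (‖x‖ + 1)).norm_image_sub_le_of_norm_hasFDerivWithin_le
        (fun z _ => (hd z).hasFDerivWithinAt)
        (fun z hz => (hω z (by simpa using hz)).2.trans (le_max_left _ _))
        (by simpa using (x.norm_coe_le_norm _).trans (by linarith))
        (by simpa using (y.norm_coe_le_norm _).trans hyρ)
    have hyx : ‖y (σ ω) - x (σ ω)‖ ≤ ‖y - x‖ := (y - x).norm_coe_le_norm (σ ω)
    have hder : ‖g' ω (x (σ ω)) ((y - x) (σ ω))‖ ≤ max l 0 * ‖y (σ ω) - x (σ ω)‖ := by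
      refine (ContinuousLinearMap.le_opNorm _ _).trans ?_
      gcongr
      · exact (hω _ ((x.norm_coe_le_norm _).trans (by linarith))).2.trans (le_max_left _ _)
      · rfl
    have h3 : ‖g ω (y (σ ω)) - g ω (x (σ ω)) - g' ω (x (σ ω)) ((y - x) (σ ω))‖
        ≤ ‖y - x‖ * (2 * max l 0) := by
      refine (norm_sub_le _ _).trans ?_
      nlinarith [le_max_right l 0, norm_nonneg (y (σ ω) - x (σ ω))]
    simp only [Φ, norm_smul, norm_inv, norm_norm]
    exact inv_mul_le_of_le_mul₀ (norm_nonneg _)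
      (mul_nonneg zero_le_two (le_max_right _ _)) h3
  · -- For almost every `ω` this is the differentiability of `g ω` at `x (σ ω)`.
    filter_upwards [hg.hasFDerivAt] with ω hd
    have h1 := (hasFDerivAt_iff_isLittleO.1 (hd (x (σ ω)))).comp_tendsto
      (((continuous_eval_const (F := C(T, G)) (σ ω)).tendsto x))
    have h2 : (fun y : C(T, G) => y (σ ω) - x (σ ω)) =O[𝓝 x] fun y => ‖y - x‖ :=
      Asymptotics.IsBigO.of_bound 1 (Eventually.of_forall fun y => by
        simpa using (y - x).norm_coe_le_norm (σ ω))
    exact (h1.trans_isBigO h2).tendsto_inv_smul_nhds_zero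

theorem continuous_nemytskiiDeriv (hg : IsC1Integrand ν σ g g') (hσ : Measurable σ) :
    Continuous (hg.nemytskiiDeriv hσ) := by
  rw [continuous_iff_continuousAt]
  intro x
  rw [ContinuousAt, tendsto_iff_norm_sub_tendsto_zero]
  let Φ : C(T, G) → Ω → G →L[ℝ] F := fun y ω => g' ω (y (σ ω)) - g' ω (x (σ ω))
  obtain ⟨l, hl0, hl⟩ := hg.ae_norm_deriv_apply_le (‖x‖ + 1)
  have hb : ∀ᶠ y in 𝓝 x, ∀ᵐ ω ∂ν, ‖Φ y ω‖ ≤ l + l := by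
    filter_upwards [Metric.closedBall_mem_nhds x one_pos] with y hy
    rw [Metric.mem_closedBall, dist_eq_norm] at hy
    have hyρ : ‖y‖ ≤ ‖x‖ + 1 := by
      have := norm_add_le x (y - x)
      rw [add_sub_cancel] at this
      linarith
    filter_upwards [hl x (by linarith), hl y hyρ] with ω h1 h2
    exact (norm_sub_le _ _).trans (add_le_add h2 h1)
  have hΦm : ∀ y, AEStronglyMeasurable (Φ y) ν := fun y =>
    (hg.meas_deriv y).sub (hg.meas_deriv x)
  have ht : Tendsto (fun y => eLpNorm (Φ y) 2 ν) (𝓝 x) (𝓝 0) := by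
    refine tendsto_eLpNorm_two_zero hΦm hb ?_
    filter_upwards [hg.continuous_deriv] with ω hω
    have := (hω.comp (continuous_eval_const (F := C(T, G)) (σ ω))).tendsto x
    simpa [Φ] using this.sub_const (g' ω (x (σ ω)))
  have ht' := (ENNReal.tendsto_toReal ENNReal.zero_ne_top).comp ht
  rw [ENNReal.toReal_zero] at ht'
  refine squeeze_zero' (Eventually.of_forall fun _ => norm_nonneg _) ?_ ht'
  filter_upwards [hb] with y hy
  refine ContinuousLinearMap.opNorm_le_bound _ ENNReal.toReal_nonneg fun h => ?_
  have hfin : MemLp (Φ y) 2 ν := MemLp.of_bound (hΦm y) _ hy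
  rw [sub_apply, nemytskiiDeriv_apply, nemytskiiDeriv_apply,
    ← MemLp.toLp_sub, Function.comp_apply, ← Lp.norm_toLp _ hfin, mul_comm]
  refine Lp.norm_le_mul_norm_of_ae_le_mul ?_
  filter_upwards [((hg.memLp_deriv hσ y h).sub (hg.memLp_deriv hσ x h)).coeFn_toLp,
    hfin.coeFn_toLp] with ω h1 h2
  rw [h1, h2, mul_comm, Pi.sub_apply, ← sub_apply]
  exact (ContinuousLinearMap.le_opNorm _ _).trans
    (mul_le_mul_of_nonneg_left (h.norm_coe_le_norm _) (norm_nonneg _))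

theorem contDiff_nemytskii (hg : IsC1Integrand ν σ g g') (hσ : Measurable σ) :
    ContDiff ℝ 1 hg.nemytskii :=
  contDiff_one_iff_hasFDerivAt.2
    ⟨_, hg.continuous_nemytskiiDeriv hσ, hg.hasFDerivAt_nemytskii hσ⟩

end IsC1Integrand

/-! ### Primitives and the space `AC₀²` -/

theorem eLpNorm_two_sq {Ω F : Type*} [MeasurableSpace Ω] [NormedAddCommGroup F] (ν : Measure Ω)
    (f : Ω → F) : eLpNorm f 2 ν ^ (2 : ℝ) = ∫⁻ ω, ‖f ω‖ₑ ^ (2 : ℝ) ∂ν := by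
  rw [eLpNorm_eq_lintegral_rpow_enorm_toReal (by norm_num) (by norm_num), ← ENNReal.rpow_mul]
  norm_num

section IntegrateSecond

variable {Ω Ω' F : Type*} [MeasurableSpace Ω] [MeasurableSpace Ω'] {μ : Measure Ω}
  {ν : Measure Ω'} [IsFiniteMeasure ν] [NormedAddCommGroup F]
  [NormedSpace ℝ F]

theorem eLpNorm_integral_prod_le {Ψ : Ω × Ω' → F} (hΨ : MemLp Ψ 2 (μ.prod ν)) :
    eLpNorm (fun t => ∫ τ, Ψ (t, τ) ∂ν) 2 μ
      ≤ ν univ ^ (1 / 2 : ℝ) * eLpNorm Ψ 2 (μ.prod ν) := by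
  rw [← ENNReal.rpow_le_rpow_iff (z := 2) two_pos, ENNReal.mul_rpow_of_nonneg _ _ zero_le_two,
    eLpNorm_two_sq, eLpNorm_two_sq, ← ENNReal.rpow_mul, lintegral_prod _
      (hΨ.1.enorm.pow_const _), ← lintegral_const_mul']
  · refine lintegral_mono_ae ?_
    filter_upwards [hΨ.1.prodMk_left] with t ht
    have h1 : ‖∫ τ, Ψ (t, τ) ∂ν‖ₑ ≤ eLpNorm (fun τ => Ψ (t, τ)) 1 ν := by
      rw [eLpNorm_one_eq_lintegral_enorm]
      exact enorm_integral_le_lintegral_enorm _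
    have h2 := h1.trans (eLpNorm_le_eLpNorm_mul_rpow_measure_univ
      (one_le_two : (1 : ENNReal) ≤ 2) ht)
    refine (ENNReal.rpow_le_rpow h2 zero_le_two).trans (le_of_eq ?_)
    rw [ENNReal.mul_rpow_of_nonneg _ _ zero_le_two, eLpNorm_two_sq, ← ENNReal.rpow_mul, mul_comm]
    norm_num
  · norm_num

theorem memLp_integral_prod {Ψ : Ω × Ω' → F} (hΨ : MemLp Ψ 2 (μ.prod ν)) :
    MemLp (fun t => ∫ τ, Ψ (t, τ) ∂ν) 2 μ :=
  ⟨hΨ.1.integral_prod_right', (eLpNorm_integral_prod_le hΨ).trans_lt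
    (ENNReal.mul_lt_top (ENNReal.rpow_lt_top_of_nonneg (by norm_num) (measure_ne_top _ _)) hΨ.2)⟩

variable [IsFiniteMeasure μ]

variable (μ ν F) in
/-- Integration with respect to the second variable, as a bounded map of `L²` spaces. -/
def integrateSecond : Lp F 2 (μ.prod ν) →L[ℝ] Lp F 2 μ :=
  LinearMap.mkContinuous
    { toFun := fun Ψ => (memLp_integral_prod (Lp.memLp Ψ)).toLp
      map_add' := fun Ψ Ψ' => by
        rw [← MemLp.toLp_add, MemLp.toLp_eq_toLp_iff]
        have h1 := Measure.ae_ae_of_ae_prod (Lp.coeFn_add Ψ Ψ')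
        have h2 := ((Lp.memLp Ψ).integrable one_le_two).prod_right_ae
        have h3 := ((Lp.memLp Ψ').integrable one_le_two).prod_right_ae
        filter_upwards [h1, h2, h3] with t h1 h2 h3
        rw [Pi.add_apply, ← integral_add h2 h3]
        exact integral_congr_ae h1
      map_smul' := fun c Ψ => by
        rw [RingHom.id_apply, ← MemLp.toLp_const_smul, MemLp.toLp_eq_toLp_iff]
        filter_upwards [Measure.ae_ae_of_ae_prod (Lp.coeFn_smul c Ψ)] with t h1
        rw [Pi.smul_apply, ← integral_smul]
        exact integral_congr_ae h1 }
    (ν univ ^ (1 / 2 : ℝ)).toReal (fun Ψ => by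
      change ‖(memLp_integral_prod (Lp.memLp Ψ)).toLp‖ ≤ _
      rw [Lp.norm_toLp, Lp.norm_def, ← ENNReal.toReal_mul]
      exact ENNReal.toReal_mono (ENNReal.mul_ne_top
        (ENNReal.rpow_ne_top_of_nonneg (by norm_num) (measure_ne_top _ _))
        (Lp.memLp Ψ).2.ne) (eLpNorm_integral_prod_le (Lp.memLp Ψ)))

theorem integrateSecond_ae_eq (Ψ : Lp F 2 (μ.prod ν)) :
    integrateSecond F μ ν Ψ =ᵐ[μ] fun t => ∫ τ, Ψ (t, τ) ∂ν :=
  (memLp_integral_prod (Lp.memLp Ψ)).coeFn_toLp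

end IntegrateSecond

/-- The Cauchy–Schwarz inequality for nonnegative functions. -/
theorem integral_mul_le_sqrt_mul_sqrt {Ω : Type*} [MeasurableSpace Ω] {ν : Measure Ω}
    {f g : Ω → ℝ} (hf0 : 0 ≤ᵐ[ν] f) (hg0 : 0 ≤ᵐ[ν] g) (hf : MemLp f 2 ν) (hg : MemLp g 2 ν) :
    ∫ ω, f ω * g ω ∂ν ≤ √(∫ ω, f ω ^ 2 ∂ν) * √(∫ ω, g ω ^ 2 ∂ν) := by
  have h2 : ENNReal.ofReal 2 = 2 := by norm_num
  have := integral_mul_le_Lp_mul_Lq_of_nonneg Real.HolderConjugate.two_two hf0 hg0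
    (by rwa [h2]) (by rwa [h2])
  simpa [Real.sqrt_eq_rpow] using this

/-- Absolute continuity passes to functions with smaller increments, which reduces primitives of
vector-valued functions to the real case. -/
theorem AbsolutelyContinuousOnInterval.of_dist_le {X : Type*} [PseudoMetricSpace X] {f : ℝ → X}
    {g : ℝ → ℝ} {a b : ℝ} (hg : AbsolutelyContinuousOnInterval g a b)
    (h : ∀ x ∈ uIcc a b, ∀ y ∈ uIcc a b, dist (f x) (f y) ≤ dist (g x) (g y)) :
    AbsolutelyContinuousOnInterval f a b := by
  rw [absolutelyContinuousOnInterval_iff] at hg ⊢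
  intro ε hε
  obtain ⟨δ, hδ, hg⟩ := hg ε hε
  refine ⟨δ, hδ, fun E hE hsum => (Finset.sum_le_sum fun i hi => ?_).trans_lt (hg E hE hsum)⟩
  have := hE.1 i hi
  exact h _ this.1 _ this.2

/-- The restriction to `[α, β]` of the primitive vanishing at `α` of a square integrable function
belongs to `AC₀²`, and its derivative is almost everywhere the given function. -/
theorem isAC02_integral {α β : ℝ} {n : ℕ} (hαβ : α ≤ β) {u : ℝ → EuclideanSpace ℝ (Fin n)}
    (hu : MemLp u 2 (volume.restrict (Icc α β))) :
    deriv (extendByZero (α := α) (β := β) fun t => ∫ s in α..t, u s)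
        =ᵐ[volume.restrict (Icc α β)] u ∧
      IsAC02 (α := α) (β := β) fun t => ∫ s in α..t, u s := by
  have hint : IntegrableOn u (Icc α β) := hu.integrable one_le_two
  have hI : IntervalIntegrable u volume α β :=
    (intervalIntegrable_iff_integrableOn_Icc_of_le hαβ).2 hint
  have hsub : ∀ s ∈ Icc α β, ∀ t ∈ Icc α β, IntervalIntegrable u volume s t := fun s hs t ht =>
    hI.mono_set (by rw [uIcc_of_le hαβ]; exact uIcc_subset_Icc hs ht)
  have heq : ∀ t ∈ Icc α β, extendByZero (α := α) (β := β) (fun t => ∫ s in α..t, u s) t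
      = ∫ s in α..t, u s := fun t ht => by simp only [extendByZero, ht, dif_pos]
  have hα : α ∈ Icc α β := left_mem_Icc.2 hαβ
  have hd : deriv (extendByZero (α := α) (β := β) fun t => ∫ s in α..t, u s)
      =ᵐ[volume.restrict (Icc α β)] u := by
    rw [← restrict_Ioo_eq_restrict_Icc]
    filter_upwards [ae_restrict_of_ae hI.ae_hasDerivAt_integral, ae_restrict_mem measurableSet_Ioo]
      with t h1 ht
    have h2 := h1 (by rw [uIcc_of_le hαβ]; exact Ioo_subset_Icc_self ht) α left_mem_uIcc
    refine (h2.congr_of_eventuallyEq ?_).deriv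
    filter_upwards [Ioo_mem_nhds ht.1 ht.2] with s hs
    exact heq s (Ioo_subset_Icc_self hs)
  refine ⟨hd, ?_, ?_, ?_⟩
  · refine (hI.norm.absolutelyContinuousOnInterval_intervalIntegral
      (left_mem_uIcc)).of_dist_le ?_
    rw [uIcc_of_le hαβ]
    intro s hs t ht
    rw [heq s hs, heq t ht, dist_eq_norm, Real.dist_eq,
      intervalIntegral.integral_interval_sub_left (hsub _ hα _ hs) (hsub _ hα _ ht),
      intervalIntegral.integral_interval_sub_left (hsub _ hα _ hs).norm (hsub _ hα _ ht).norm]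
    exact intervalIntegral.norm_integral_le_abs_integral_norm
  · rw [heq α hα, intervalIntegral.integral_same]
  · exact (memLp_congr_ae hd).2 hu

namespace AC02

variable {α β : ℝ} {n : ℕ}

/-- The primitive vanishing at `α`, as an isometry of `L²` into `AC₀²`. -/
def primitive (n : ℕ) (hαβ : α ≤ β) :
    Lp (EuclideanSpace ℝ (Fin n)) 2 (volume.restrict (Icc α β)) →ₗᵢ[ℝ] AC02 α β n where
  toFun u := (⟨_, (isAC02_integral hαβ (Lp.memLp u)).2⟩ : ac02Submodule α β n)
  map_add' u w := by
    refine Subtype.ext (funext fun t => ?_)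
    have h : ∀ u : Lp (EuclideanSpace ℝ (Fin n)) 2 (volume.restrict (Icc α β)),
        IntervalIntegrable u volume α t := fun u =>
      ((intervalIntegrable_iff_integrableOn_Icc_of_le t.2.1).2
        (((Lp.memLp u).integrable one_le_two).mono_measure
          (Measure.restrict_mono_set _ (Icc_subset_Icc_right t.2.2))))
    change ∫ s in α..t, (u + w : Lp (EuclideanSpace ℝ (Fin n)) 2 (volume.restrict (Icc α β))) s
      = (∫ s in α..t, u s) + ∫ s in α..t, w s
    rw [← intervalIntegral.integral_add (h u) (h w)]
    refine intervalIntegral.integral_congr_ae_restrict ?_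
    rw [uIoc_of_le t.2.1]
    exact ae_restrict_of_ae_restrict_of_subset
      (Ioc_subset_Icc_self.trans (Icc_subset_Icc_right t.2.2)) (Lp.coeFn_add u w)
  map_smul' c u := by
    refine Subtype.ext (funext fun t => ?_)
    change ∫ s in α..t, (c • u : Lp (EuclideanSpace ℝ (Fin n)) 2 (volume.restrict (Icc α β))) s
      = c • ∫ s in α..t, u s
    rw [← intervalIntegral.integral_smul]
    refine intervalIntegral.integral_congr_ae_restrict ?_
    rw [uIoc_of_le t.2.1]
    exact ae_restrict_of_ae_restrict_of_subset
      (Ioc_subset_Icc_self.trans (Icc_subset_Icc_right t.2.2)) (Lp.coeFn_smul c u)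
  norm_map' u := by
    rw [norm_eq_norm_derivLp]
    congr 1
    exact Lp.ext (((MemLp.coeFn_toLp _)).trans (isAC02_integral hαβ (Lp.memLp u)).1)

theorem coe_eq (x : AC02 α β n) {t : ℝ} (ht : t ∈ Icc α β) : x t = x.1 ⟨t, ht⟩ := by
  simp only [extendByZero, ht, dif_pos]

theorem primitive_apply (hαβ : α ≤ β)
    (u : Lp (EuclideanSpace ℝ (Fin n)) 2 (volume.restrict (Icc α β))) {t : ℝ}
    (ht : t ∈ Icc α β) : primitive n hαβ u t = ∫ s in α..t, u s := coe_eq _ ht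

theorem derivLp_primitive (hαβ : α ≤ β)
    (u : Lp (EuclideanSpace ℝ (Fin n)) 2 (volume.restrict (Icc α β))) :
    derivLp (primitive n hαβ u) = u :=
  Lp.ext (((MemLp.coeFn_toLp _)).trans (isAC02_integral hαβ (Lp.memLp u)).1)

theorem primitive_derivLp (hαβ : α ≤ β) (x : AC02 α β n) :
    primitive n hαβ (derivLp x) = x := by
  rw [← sub_eq_zero]
  refine eq_zero_of_derivLp_eq_zero _ ?_
  rw [sub_eq_add_neg, ← neg_one_smul ℝ x, derivLp_add, derivLp_smul, derivLp_primitive]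
  simp

/-- The fundamental estimate `|x(t)| ≤ (t - α)^{1/2} ‖x‖`. -/
theorem norm_apply_le (hαβ : α ≤ β) (x : AC02 α β n) {t : ℝ} (ht : t ∈ Icc α β) :
    ‖x t‖ ≤ √(t - α) * ‖x‖ := by
  have hm : MemLp (derivLp x) 2 (volume.restrict (Icc α β)) := Lp.memLp _
  have hmt : MemLp (derivLp x) 2 (volume.restrict (Icc α t)) :=
    hm.mono_measure (Measure.restrict_mono_set _ (Icc_subset_Icc_right ht.2))
  have h1 : x t = ∫ s in α..t, derivLp x s := by
    conv_lhs => rw [← primitive_derivLp hαβ x]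
    exact primitive_apply hαβ _ ht
  rw [h1, intervalIntegral.integral_of_le ht.1, ← integral_Icc_eq_integral_Ioc]
  refine (norm_integral_le_integral_norm _).trans ?_
  have h2 := integral_mul_le_sqrt_mul_sqrt (ν := volume.restrict (Icc α t))
    (f := fun _ => 1) (g := fun s => ‖derivLp x s‖) (Eventually.of_forall fun _ => zero_le_one)
    (Eventually.of_forall fun _ => norm_nonneg _) (memLp_const 1) hmt.norm
  simp only [one_mul, one_pow, integral_const, smul_eq_mul, mul_one, Measure.real,
    Measure.restrict_apply_univ, Real.volume_Icc, ENNReal.toReal_ofReal (sub_nonneg.2 ht.1)] at h2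
  refine h2.trans ?_
  gcongr
  rw [norm_def]
  refine Real.sqrt_le_sqrt ?_
  have h3 : ∫ s in Icc α β, ‖deriv x s‖ ^ 2 = ∫ s in Icc α β, ‖derivLp x s‖ ^ 2 := by
    refine integral_congr_ae ?_
    filter_upwards [x.2.deriv_memLp.coeFn_toLp] with s hs
    rw [derivLp, hs]
  rw [h3]
  exact setIntegral_mono_set ((memLp_two_iff_integrable_sq_norm hm.1).1 hm)
    (Eventually.of_forall fun _ => sq_nonneg _)
    (Eventually.of_forall (Icc_subset_Icc_right ht.2))

/-- The embedding of `AC₀²` into the space of continuous functions. -/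
def toContinuous (n : ℕ) (hαβ : α ≤ β) :
    AC02 α β n →L[ℝ] C(Icc α β, EuclideanSpace ℝ (Fin n)) :=
  LinearMap.mkContinuous
    { toFun := fun x => ⟨fun t => x t, by
        have h := x.2.absCont.continuousOn
        rw [uIcc_of_le hαβ] at h
        exact h.domRestrict⟩
      map_add' := fun x y => ContinuousMap.ext fun t => congrFun (coe_add x y) t
      map_smul' := fun c x => ContinuousMap.ext fun t => congrFun (coe_smul c x) t }
    √(β - α) (fun x => by
      rw [ContinuousMap.norm_le _ (by positivity)]
      intro t
      refine (norm_apply_le hαβ x t.2).trans ?_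
      gcongr
      exact t.2.2)

@[simp]
theorem toContinuous_apply (hαβ : α ≤ β) (x : AC02 α β n) (t : Icc α β) :
    toContinuous n hαβ x t = x t := rfl

theorem toContinuous_injective (hαβ : α ≤ β) : Function.Injective (toContinuous n hαβ) :=
  fun _ _ h => ext_of_forall fun t ht => DFunLike.congr_fun h (⟨t, ht⟩ : Icc α β)

end AC02

/-! ### The integral operator as a continuously differentiable map into `AC₀²` -/

section Integrand

variable {α β : ℝ} {n : ℕ} {F : Type*} [NormedAddCommGroup F] [NormedSpace ℝ F]
  {Ω : Type*} [MeasurableSpace Ω] {ν : Measure Ω}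

/-- A kernel of class `C¹` in `x` yields a `C¹` integrand after a substitution
`ω ↦ (θ(ω), σ(ω))` of its arguments `(t, τ)` and extension by `0` off a set that is mapped into the
triangle. -/
theorem isC1Integrand_of_kernel (hαβ : α ≤ β) {f : ℝ → ℝ → EuclideanSpace ℝ (Fin n) → F}
    {f' : ℝ → ℝ → EuclideanSpace ℝ (Fin n) → EuclideanSpace ℝ (Fin n) →L[ℝ] F}
    (hc : ∀ᵐ τ ∂(volume.restrict (Icc α β)),
      ContinuousOn (fun p : ℝ × EuclideanSpace ℝ (Fin n) => f p.1 τ p.2) (Icc τ β ×ˢ univ))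
    (hc' : ∀ᵐ τ ∂(volume.restrict (Icc α β)),
      ContinuousOn (fun p : ℝ × EuclideanSpace ℝ (Fin n) => f' p.1 τ p.2) (Icc τ β ×ˢ univ))
    (hd : ∀ᵐ τ ∂(volume.restrict (Icc α β)), ∀ t ∈ Icc τ β, ∀ x,
      HasFDerivAt (fun y => f t τ y) (f' t τ x) x)
    (hb : MeasurableLocallyBounded α β f) (hb' : MeasurableLocallyBounded α β f')
    {θ σ : Ω → ℝ} (hθ : Measurable θ)
    (hσ : Measure.QuasiMeasurePreserving σ ν (volume.restrict (Icc α β)))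
    {D : Set Ω} (hD : MeasurableSet D)
    (hmem : ∀ᵐ ω ∂ν, ω ∈ D → α ≤ σ ω ∧ σ ω ≤ θ ω ∧ θ ω ≤ β) :
    IsC1Integrand ν (fun ω => projIcc α β hαβ (σ ω))
      (fun ω y => D.indicator (fun ω => f (θ ω) (σ ω) y) ω)
      (fun ω y => D.indicator (fun ω => f' (θ ω) (σ ω) y) ω) := by
  have hξ : ∀ x : C(Icc α β, EuclideanSpace ℝ (Fin n)),
      StronglyMeasurable fun ω => x (projIcc α β hαβ (σ ω)) := fun x =>
    (x.continuous.comp continuous_projIcc).stronglyMeasurable.comp_measurable hσ.measurable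
  have hσD : Measure.QuasiMeasurePreserving σ (ν.restrict D) (volume.restrict (Icc α β)) :=
    hσ.mono_left Measure.restrict_le_self.absolutelyContinuous
  have hmemD : ∀ᵐ ω ∂(ν.restrict D), α ≤ σ ω ∧ σ ω ≤ θ ω ∧ θ ω ≤ β :=
    (ae_restrict_iff' hD).2 hmem
  refine ⟨fun x => ?_, fun x => ?_, ?_, ?_, fun ρ => ?_⟩
  · exact (aestronglyMeasurable_indicator_iff hD).2
      (aestronglyMeasurable_superposition hαβ hc hb.measurable hθ hσD (hξ x) hmemD)
  · exact (aestronglyMeasurable_indicator_iff hD).2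
      (aestronglyMeasurable_superposition hαβ hc' hb'.measurable hθ hσD (hξ x) hmemD)
  · filter_upwards [hσ.ae hd, hmem] with ω h1 h2 y
    by_cases hω : ω ∈ D
    · simpa [hω] using h1 _ (h2 hω).2 y
    · simpa [hω] using hasFDerivAt_const (0 : F) y
  · filter_upwards [hσ.ae hc', hmem] with ω h1 h2
    by_cases hω : ω ∈ D
    · simp only [hω, indicator_of_mem]
      exact h1.comp_continuous (by fun_prop : Continuous fun y => (θ ω, y))
        fun y => ⟨(h2 hω).2, mem_univ _⟩
    · simpa [hω] using continuous_const
  · obtain ⟨l, hl0, hl⟩ := hb.bounded (max ρ 1) (by positivity)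
    obtain ⟨l', -, hl'⟩ := hb'.bounded (max ρ 1) (by positivity)
    refine ⟨max l l', ?_⟩
    filter_upwards [hσ.ae hl, hσ.ae hl', hmem] with ω h1 h2 h3 y hy
    by_cases hω : ω ∈ D
    · simp only [hω, indicator_of_mem]
      exact ⟨(h1 _ (h3 hω).2 y (le_max_of_le_left hy)).trans (le_max_left _ _),
        (h2 _ (h3 hω).2 y (le_max_of_le_left hy)).trans (le_max_right _ _)⟩
    · simp [hω, hl0.le]

end Integrand

section Kernel

variable {α β : ℝ} {n : ℕ}
  {v : ℝ → ℝ → EuclideanSpace ℝ (Fin n) → EuclideanSpace ℝ (Fin n)}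

theorem isC1Integrand_diagonal (hαβ : α ≤ β) (hA1 : ConditionA1 α β v)
    (hA2 : ConditionA2 α β v) :
    IsC1Integrand (volume.restrict (Icc α β)) (projIcc α β hαβ) (fun t y => v t t y)
      (fun t y => vx v t t y) := by
  have := isC1Integrand_of_kernel (ν := volume.restrict (Icc α β)) hαβ hA1.a
    (hA1.c.mono fun _ h => h.2) (hA1.c.mono fun τ h t ht x => (h.1 t ht x).hasFDerivAt)
    hA2.a hA2.c measurable_id (Measure.QuasiMeasurePreserving.id _) MeasurableSet.univ
    (by filter_upwards [ae_restrict_mem measurableSet_Icc] with t ht _ using ⟨ht.1, le_rfl, ht.2⟩)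
  simpa using this

theorem isC1Integrand_triangle (hαβ : α ≤ β) (hA1 : ConditionA1 α β v)
    (hA2 : ConditionA2 α β v) :
    IsC1Integrand ((volume.restrict (Icc α β)).prod (volume.restrict (Icc α β)))
      (fun p => projIcc α β hαβ p.2)
      (fun p y => {p : ℝ × ℝ | p.2 ≤ p.1}.indicator (fun p => vt β v p.1 p.2 y) p)
      (fun p y => {p : ℝ × ℝ | p.2 ≤ p.1}.indicator (fun p => vtx β v p.1 p.2 y) p) := by
  refine isC1Integrand_of_kernel hαβ (hA1.b.mono fun _ h => h.2)
    (hA1.d.mono fun _ h => h.2) (hA1.d.mono fun τ h t ht x => (h.1 t ht x).hasFDerivAt)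
    hA2.b hA2.d measurable_fst Measure.quasiMeasurePreserving_snd
    (measurableSet_le measurable_snd measurable_fst) ?_
  filter_upwards [Measure.quasiMeasurePreserving_fst.ae (ae_restrict_mem measurableSet_Icc),
    Measure.quasiMeasurePreserving_snd.ae (ae_restrict_mem measurableSet_Icc)] with p h1 h2 h3
  exact ⟨h2.1, h3, h1.2⟩

theorem measurable_projIcc (hαβ : α ≤ β) : Measurable (projIcc α β hαβ) :=
  continuous_projIcc.measurable

/-- The superposition `τ ↦ v(t, τ, x(τ))` is integrable for continuous `x`. -/
theorem integrableOn_kernel (hαβ : α ≤ β) (hA1 : ConditionA1 α β v)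
    (hA2 : ConditionA2 α β v) (x : C(Icc α β, EuclideanSpace ℝ (Fin n))) {t : ℝ}
    (ht : t ∈ Icc α β) :
    IntegrableOn (fun τ => v t τ (x (projIcc α β hαβ τ))) (Icc α t) := by
  have hle : volume.restrict (Icc α t) ≤ volume.restrict (Icc α β) :=
    Measure.restrict_mono_set _ (Icc_subset_Icc_right ht.2)
  obtain ⟨l, -, hl⟩ := hA2.a.bounded (max ‖x‖ 1) (by positivity)
  refine Integrable.of_bound ?_ l ?_
  · refine aestronglyMeasurable_superposition hαβ hA1.a hA2.a.measurable
      (ν := volume.restrict (Icc α t)) (θ := fun _ => t) measurable_const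
      ((Measure.QuasiMeasurePreserving.id _).mono_left hle.absolutelyContinuous)
      (x.continuous.comp continuous_projIcc).stronglyMeasurable ?_
    filter_upwards [ae_restrict_mem measurableSet_Icc] with τ hτ
    exact ⟨hτ.1, hτ.2, ht.2⟩
  · filter_upwards [ae_mono hle hl, ae_restrict_mem measurableSet_Icc] with τ h1 hτ
    exact h1 t ⟨hτ.2, ht.2⟩ _ (le_max_of_le_left (x.norm_coe_le_norm _))

theorem setIntegral_indicator_le {F : Type*} [NormedAddCommGroup F] [NormedSpace ℝ F]
    {t : ℝ} (ht : t ∈ Icc α β) (f : ℝ → F) :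
    ∫ τ in Icc α β, (if τ ≤ t then f τ else 0) = ∫ τ in Icc α t, f τ := by
  have h : (fun τ => if τ ≤ t then f τ else 0) = (Iic t).indicator f := by
    funext τ
    simp [indicator_apply]
  rw [h, setIntegral_indicator measurableSet_Iic]
  congr 2
  ext τ
  simp only [mem_inter_iff, mem_Icc, mem_Iic]
  exact ⟨fun h => ⟨h.1.1, h.2⟩, fun h => ⟨⟨h.1, h.2.trans ht.2⟩, h.2⟩⟩

/-- By Fubini and the fundamental theorem of calculus, the primitive of
`v(s, s, x(s)) + ∫_α^s v_t(s, τ, x(τ)) dτ` is `∫_α^t v(t, τ, x(τ)) dτ`. -/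
theorem integral_diagonal_add_triangle (hαβ : α ≤ β) (hA1 : ConditionA1 α β v)
    (hA2 : ConditionA2 α β v) (x : C(Icc α β, EuclideanSpace ℝ (Fin n))) {t : ℝ}
    (ht : t ∈ Icc α β) :
    ∫ s in Icc α t, (v s s (x (projIcc α β hαβ s))
        + ∫ τ in Icc α s, vt β v s τ (x (projIcc α β hαβ τ)))
      = ∫ τ in Icc α t, v t τ (x (projIcc α β hαβ τ)) := by
  have hle : volume.restrict (Icc α t) ≤ volume.restrict (Icc α β) :=
    Measure.restrict_mono_set _ (Icc_subset_Icc_right ht.2)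
  have hdiag : IntegrableOn (fun s => v s s (x (projIcc α β hαβ s))) (Icc α t) :=
    (((isC1Integrand_diagonal hαβ hA1 hA2).memLp x).integrable one_le_two).mono_measure hle
  let Ψ : ℝ × ℝ → EuclideanSpace ℝ (Fin n) := fun p =>
    if p.2 ≤ p.1 then vt β v p.1 p.2 (x (projIcc α β hαβ p.2)) else 0
  have hΨ : Integrable Ψ ((volume.restrict (Icc α β)).prod (volume.restrict (Icc α β))) := by
    refine (((isC1Integrand_triangle hαβ hA1 hA2).memLp x).integrable one_le_two).congr ?_
    exact Eventually.of_forall fun p => by simp [Ψ, indicator_apply]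
  have hΨt : Integrable Ψ ((volume.restrict (Icc α t)).prod (volume.restrict (Icc α β))) :=
    hΨ.mono_measure (Measure.prod_mono hle le_rfl)
  have h1 : ∀ s ∈ Icc α t, ∫ τ in Icc α s, vt β v s τ (x (projIcc α β hαβ τ))
      = ∫ τ in Icc α β, Ψ (s, τ) := fun s hs =>
    (setIntegral_indicator_le ⟨hs.1, hs.2.trans ht.2⟩ _).symm
  have h2 : ∫ s in Icc α t, ∫ τ in Icc α s, vt β v s τ (x (projIcc α β hαβ τ))
      = ∫ τ in Icc α β, ∫ s in Icc α t, Ψ (s, τ) := by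
    rw [setIntegral_congr_fun measurableSet_Icc h1]
    exact integral_integral_swap hΨt
  have h3 : ∀ᵐ τ ∂(volume.restrict (Icc α β)), ∫ s in Icc α t, Ψ (s, τ)
      = if τ ≤ t then v t τ (x (projIcc α β hαβ τ)) - v τ τ (x (projIcc α β hαβ τ)) else 0 := by
    filter_upwards [hA1.a, hA1.b, ae_restrict_mem measurableSet_Icc] with τ ha hb hτ
    set y := x (projIcc α β hαβ τ) with hy
    by_cases hτt : τ ≤ t
    · -- The fundamental theorem of calculus for `v(·, τ, y)` on `[τ, t]`.
      rw [if_pos hτt]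
      have e1 : ∫ s in Icc α t, Ψ (s, τ) = ∫ s in Icc τ t, vt β v s τ y := by
        have : (fun s => Ψ (s, τ)) = (Ici τ).indicator fun s => vt β v s τ y := by
          funext s
          simp [Ψ, indicator_apply, hy]
        rw [this, setIntegral_indicator measurableSet_Ici]
        congr 2
        ext s
        simp only [mem_inter_iff, mem_Icc, mem_Ici]
        exact ⟨fun h => ⟨h.2, h.1.2⟩, fun h => ⟨⟨hτ.1.trans h.1, h.2⟩, h.1⟩⟩
      have hsub : Icc τ t ⊆ Icc τ β := Icc_subset_Icc_right ht.2
      have c1 : ContinuousOn (fun s => v s τ y) (Icc τ t) :=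
        ha.comp (by fun_prop : Continuous fun s : ℝ => (s, y)).continuousOn
          fun s hs => ⟨hsub hs, mem_univ _⟩
      have c2 : ContinuousOn (fun s => vt β v s τ y) (Icc τ t) :=
        hb.2.comp (by fun_prop : Continuous fun s : ℝ => (s, y)).continuousOn
          fun s hs => ⟨hsub hs, mem_univ _⟩
      rw [e1, integral_Icc_eq_integral_Ioc, ← intervalIntegral.integral_of_le hτt]
      refine intervalIntegral.integral_eq_sub_of_hasDerivAt_of_le hτt c1 (fun s hs => ?_)
        (c2.intervalIntegrable_of_Icc hτt)
      exact (hb.1 s (hsub (Ioo_subset_Icc_self hs)) y).hasDerivWithinAt.hasDerivAt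
        (Icc_mem_nhds hs.1 (hs.2.trans_le ht.2))
    · rw [if_neg hτt]
      refine setIntegral_eq_zero_of_forall_eq_zero fun s hs => ?_
      exact if_neg fun h : τ ≤ s => hτt (h.trans hs.2)
  have hΨs : Integrable (fun s => ∫ τ in Icc α s, vt β v s τ (x (projIcc α β hαβ τ)))
      (volume.restrict (Icc α t)) := by
    refine hΨt.integral_prod_left.congr ?_
    filter_upwards [ae_restrict_mem measurableSet_Icc] with s hs using (h1 s hs).symm
  rw [integral_add hdiag hΨs, h2, integral_congr_ae h3, setIntegral_indicator_le ht,
    integral_sub (integrableOn_kernel hαβ hA1 hA2 x ht) hdiag, add_sub_cancel]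

/-- The integral operator `K(x)(t) = ∫_α^t v(t, τ, x(τ)) dτ`, from continuous functions to
`AC₀²`. It is built as the primitive of the formula for its derivative. -/
def volterraIntegral (hαβ : α ≤ β) (hA1 : ConditionA1 α β v) (hA2 : ConditionA2 α β v)
    (x : C(Icc α β, EuclideanSpace ℝ (Fin n))) : AC02 α β n :=
  AC02.primitive n hαβ ((isC1Integrand_diagonal hαβ hA1 hA2).nemytskii x
    + integrateSecond _ _ _ ((isC1Integrand_triangle hαβ hA1 hA2).nemytskii x))

theorem contDiff_volterraIntegral (hαβ : α ≤ β) (hA1 : ConditionA1 α β v)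
    (hA2 : ConditionA2 α β v) : ContDiff ℝ 1 (volterraIntegral hαβ hA1 hA2) := by
  have hp := measurable_projIcc hαβ
  have h1 := (isC1Integrand_diagonal hαβ hA1 hA2).contDiff_nemytskii hp
  have h2 := (isC1Integrand_triangle hαβ hA1 hA2).contDiff_nemytskii (hp.comp measurable_snd)
  exact (AC02.primitive n hαβ).toContinuousLinearMap.contDiff.comp
    (h1.add ((integrateSecond (EuclideanSpace ℝ (Fin n)) (volume.restrict (Icc α β))
      (volume.restrict (Icc α β))).contDiff.comp h2))

theorem derivLp_volterraIntegral (hαβ : α ≤ β) (hA1 : ConditionA1 α β v)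
    (hA2 : ConditionA2 α β v) (x : C(Icc α β, EuclideanSpace ℝ (Fin n))) :
    AC02.derivLp (volterraIntegral hαβ hA1 hA2 x) =ᵐ[volume.restrict (Icc α β)] fun t =>
      v t t (x (projIcc α β hαβ t)) + ∫ τ in Icc α t, vt β v t τ (x (projIcc α β hαβ τ)) := by
  rw [volterraIntegral, AC02.derivLp_primitive]
  set N := (isC1Integrand_triangle hαβ hA1 hA2).nemytskii x
  filter_upwards [Lp.coeFn_add ((isC1Integrand_diagonal hαβ hA1 hA2).nemytskii x)
      (integrateSecond _ _ _ N), (isC1Integrand_diagonal hαβ hA1 hA2).nemytskii_ae_eq x,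
    integrateSecond_ae_eq N,
    Measure.ae_ae_of_ae_prod ((isC1Integrand_triangle hαβ hA1 hA2).nemytskii_ae_eq x),
    ae_restrict_mem measurableSet_Icc] with t h1 h2 h3 h4 ht
  rw [h1, Pi.add_apply, h2, h3, integral_congr_ae h4, ← setIntegral_indicator_le ht]
  simp [indicator_apply]

theorem volterraIntegral_apply (hαβ : α ≤ β) (hA1 : ConditionA1 α β v)
    (hA2 : ConditionA2 α β v) (x : C(Icc α β, EuclideanSpace ℝ (Fin n))) {t : ℝ}
    (ht : t ∈ Icc α β) :
    volterraIntegral hαβ hA1 hA2 x t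
      = ∫ τ in α..t, v t τ (x (projIcc α β hαβ τ)) := by
  have h := derivLp_volterraIntegral hαβ hA1 hA2 x
  rw [volterraIntegral, AC02.derivLp_primitive] at h
  rw [volterraIntegral, AC02.primitive_apply hαβ _ ht, intervalIntegral.integral_of_le ht.1,
    intervalIntegral.integral_of_le ht.1, ← integral_Icc_eq_integral_Ioc,
    ← integral_Icc_eq_integral_Ioc, ← integral_diagonal_add_triangle hαβ hA1 hA2 x ht]
  exact integral_congr_ae (ae_restrict_of_ae_restrict_of_subset (Icc_subset_Icc_right ht.2) h)

end Kernel

/-! ### Operators of Volterra type -/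

section Volterra

variable {α β : ℝ} {G : Type*} [NormedAddCommGroup G]

theorem continuous_norm_comp_projIcc (hαβ : α ≤ β) (x : C(Icc α β, G)) :
    Continuous fun τ => ‖x (projIcc α β hαβ τ)‖ :=
  (x.continuous.comp continuous_projIcc).norm

/-- The integral form of Grönwall's inequality. -/
theorem norm_le_of_le_add_integral (hαβ : α ≤ β) {z : C(Icc α β, G)} {ε L : ℝ} (hε : 0 ≤ ε)
    (hL : 0 ≤ L)
    (h : ∀ t : Icc α β, ‖z t‖ ≤ ε + L * ∫ τ in α..t, ‖z (projIcc α β hαβ τ)‖) :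
    ‖z‖ ≤ ε * Real.exp (L * (β - α)) := by
  have hc := continuous_norm_comp_projIcc hαβ z
  let Φ : ℝ → ℝ := fun t => ε + L * ∫ τ in α..t, ‖z (projIcc α β hαβ τ)‖
  have hΦd : ∀ t, HasDerivAt Φ (L * ‖z (projIcc α β hαβ t)‖) t := fun t =>
    ((hc.integral_hasStrictDerivAt α t).hasDerivAt.const_mul L).const_add ε
  have hΦ : ∀ t ∈ Icc α β, ‖z (projIcc α β hαβ t)‖ ≤ Φ t := fun t ht => by
    rw [projIcc_of_mem hαβ ht]
    exact h ⟨t, ht⟩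
  have key := norm_le_gronwallBound_of_norm_deriv_right_le (f := Φ) (δ := ε) (K := L) (ε := 0)
    (a := α) (b := β) (fun t _ => (hΦd t).continuousAt.continuousWithinAt)
    (fun t _ => (hΦd t).hasDerivWithinAt) (by simp [Φ, abs_of_nonneg hε]) (fun t ht => by
      have h1 := hΦ t (Ico_subset_Icc_self ht)
      rw [add_zero, norm_mul, norm_norm, Real.norm_of_nonneg hL]
      exact mul_le_mul_of_nonneg_left (h1.trans (le_abs_self _)) hL)
  rw [ContinuousMap.norm_le _ (by positivity)]
  intro t
  have h1 := hΦ t t.2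
  rw [projIcc_val] at h1
  refine h1.trans ((le_abs_self _).trans ((key t t.2).trans ?_))
  rw [gronwallBound_ε0]
  have := t.2.2
  gcongr

theorem integral_sub_pow_div_factorial (t : ℝ) (k : ℕ) :
    ∫ τ in α..t, (τ - α) ^ k / (k.factorial : ℝ)
      = (t - α) ^ (k + 1) / ((k + 1).factorial : ℝ) := by
  rw [intervalIntegral.integral_div,
    intervalIntegral.integral_comp_sub_right (fun τ => τ ^ k) α, integral_pow,
    Nat.factorial_succ]
  push_cast
  rw [sub_self, zero_pow k.succ_ne_zero, sub_zero, div_div]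

section Linear

variable [NormedSpace ℝ G]

/-- The iterates of a linear operator of Volterra type decay like `1 / k!`. -/
theorem norm_pow_apply_le (hαβ : α ≤ β) {T : C(Icc α β, G) →L[ℝ] C(Icc α β, G)} {L : ℝ}
    (hL : 0 ≤ L)
    (hT : ∀ (h : C(Icc α β, G)) (t : Icc α β),
      ‖T h t‖ ≤ L * ∫ τ in α..t, ‖h (projIcc α β hαβ τ)‖) (h : C(Icc α β, G)) (k : ℕ) :
    ∀ t : Icc α β, ‖(T ^ k) h t‖ ≤ L ^ k * ((t - α) ^ k / (k.factorial : ℝ)) * ‖h‖ := by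
  induction k with
  | zero =>
    intro t
    simpa using h.norm_coe_le_norm t
  | succ k ih =>
    intro t
    rw [pow_succ', mul_apply_eq_comp]
    refine (hT _ t).trans ?_
    have h1 : ∫ τ in α..t, ‖(T ^ k) h (projIcc α β hαβ τ)‖
        ≤ ∫ τ in α..t, L ^ k * ((τ - α) ^ k / (k.factorial : ℝ)) * ‖h‖ := by
      refine intervalIntegral.integral_mono_on t.2.1
        (continuous_norm_comp_projIcc hαβ _).continuousOn.intervalIntegrable
        (by fun_prop : Continuous fun τ : ℝ =>
          L ^ k * ((τ - α) ^ k / (k.factorial : ℝ)) * ‖h‖).continuousOn.intervalIntegrable ?_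
      intro τ hτ
      have hτ' : τ ∈ Icc α β := ⟨hτ.1, hτ.2.trans t.2.2⟩
      rw [projIcc_of_mem hαβ hτ']
      exact ih ⟨τ, hτ'⟩
    refine (mul_le_mul_of_nonneg_left h1 hL).trans (le_of_eq ?_)
    rw [intervalIntegral.integral_mul_const, intervalIntegral.integral_const_mul,
      integral_sub_pow_div_factorial]
    ring

/-- If `T` is a linear operator of Volterra type, then `1 - T` is invertible. -/
theorem isUnit_one_sub_of_volterra [CompleteSpace G] (hαβ : α ≤ β)
    {T : C(Icc α β, G) →L[ℝ] C(Icc α β, G)} {L : ℝ} (hL : 0 ≤ L)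
    (hT : ∀ (h : C(Icc α β, G)) (t : Icc α β),
      ‖T h t‖ ≤ L * ∫ τ in α..t, ‖h (projIcc α β hαβ τ)‖) : IsUnit (1 - T) := by
  obtain ⟨k, hk⟩ := ((FloorSemiring.tendsto_pow_div_factorial_atTop (L * (β - α))).eventually
    (gt_mem_nhds one_pos)).exists
  have hpos : 0 ≤ β - α := sub_nonneg.2 hαβ
  have hnorm : ‖T ^ k‖ < 1 := by
    refine lt_of_le_of_lt (ContinuousLinearMap.opNorm_le_bound _ (by positivity) fun h => ?_) hk
    rw [ContinuousMap.norm_le _ (by positivity)]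
    intro t
    refine (norm_pow_apply_le hαβ hL hT h k t).trans ?_
    rw [mul_pow, mul_div_assoc]
    have h1 : 0 ≤ (t : ℝ) - α := sub_nonneg.2 t.2.1
    have h2 := t.2.2
    gcongr
  -- `1 - T` is a factor of the invertible operator `1 - T ^ k`.
  have hu := isUnit_one_sub_of_norm_lt_one (R := C(Icc α β, G) →L[ℝ] C(Icc α β, G)) hnorm
  have hcomm : Commute (1 - T) (∑ i ∈ Finset.range k, T ^ i) :=
    (mul_neg_geom_sum T k).trans (geom_sum_mul_neg T k).symm
  rw [← mul_neg_geom_sum T k] at hu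
  exact (hcomm.isUnit_mul_iff.1 hu).1

end Linear

/-- A (nonlinear) operator of Volterra type that is Lipschitz on bounded sets:
`|Φ(x)(t) - Φ(y)(t)| ≤ L ∫_α^t |x(τ) - y(τ)| dτ` for `x`, `y` in a ball, `L` depending on its
radius. -/
def IsLocallyVolterra (hαβ : α ≤ β) (Φ : C(Icc α β, G) → C(Icc α β, G)) : Prop :=
  ∀ ρ : ℝ, ∃ L : ℝ, 0 ≤ L ∧ ∀ x y : C(Icc α β, G), ‖x‖ ≤ ρ → ‖y‖ ≤ ρ → ∀ t : Icc α β,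
    ‖Φ x t - Φ y t‖ ≤ L * ∫ τ in α..t, ‖(x - y) (projIcc α β hαβ τ)‖

namespace IsLocallyVolterra

variable {hαβ : α ≤ β} {Φ : C(Icc α β, G) → C(Icc α β, G)}

/-- On bounded sets, the inverse of `x ↦ x + Φ(x)` is Lipschitz. -/
theorem exists_antilipschitz (hΦ : IsLocallyVolterra hαβ Φ) (ρ : ℝ) :
    ∃ C : ℝ, 0 ≤ C ∧ ∀ x y : C(Icc α β, G), ‖x‖ ≤ ρ → ‖y‖ ≤ ρ →
      ‖x - y‖ ≤ C * ‖(x + Φ x) - (y + Φ y)‖ := by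
  obtain ⟨L, hL, h⟩ := hΦ ρ
  refine ⟨Real.exp (L * (β - α)), (Real.exp_pos _).le, fun x y hx hy => ?_⟩
  rw [mul_comm]
  refine norm_le_of_le_add_integral hαβ (norm_nonneg _) hL fun t => ?_
  have h1 : (x - y) t = ((x + Φ x) - (y + Φ y)) t - (Φ x t - Φ y t) := by
    simp only [ContinuousMap.sub_apply, ContinuousMap.add_apply]
    abel
  rw [h1]
  exact (norm_sub_le _ _).trans (add_le_add (ContinuousMap.norm_coe_le_norm _ _) (h x y hx hy t))

theorem injective (hΦ : IsLocallyVolterra hαβ Φ) : Function.Injective fun x => x + Φ x := by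
  intro x y hxy
  obtain ⟨C, -, hC⟩ := hΦ.exists_antilipschitz (max ‖x‖ ‖y‖)
  have h := hC x y (le_max_left _ _) (le_max_right _ _)
  rw [show x + Φ x = y + Φ y from hxy, sub_self, norm_zero, mul_zero] at h
  exact sub_eq_zero.1 (norm_le_zero_iff.1 h)

variable [NormedSpace ℝ G]

/-- The derivative of an operator of Volterra type is a linear operator of Volterra type. -/
theorem norm_deriv_apply_le (hΦ : IsLocallyVolterra hαβ Φ) {x : C(Icc α β, G)}
    {T : C(Icc α β, G) →L[ℝ] C(Icc α β, G)} (hT : HasFDerivAt Φ T x) :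
    ∃ L : ℝ, 0 ≤ L ∧ ∀ (h : C(Icc α β, G)) (t : Icc α β),
      ‖T h t‖ ≤ L * ∫ τ in α..t, ‖h (projIcc α β hαβ τ)‖ := by
  obtain ⟨L, hL, hlip⟩ := hΦ (‖x‖ + 1)
  refine ⟨L, hL, fun h t => ?_⟩
  have hlim := (hT.hasLineDerivAt h).tendsto_slope_zero_right
  have hlim_t := (((continuous_eval_const (F := C(Icc α β, G)) t).tendsto _).comp hlim).norm
  refine le_of_tendsto hlim_t ?_
  have hsmall : ∀ᶠ s : ℝ in 𝓝[>] 0, ‖x + s • h‖ ≤ ‖x‖ + 1 := by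
    have hcont : Continuous fun s : ℝ => ‖x + s • h‖ := by fun_prop
    have := hcont.tendsto 0
    simp only [zero_smul, add_zero] at this
    exact nhdsWithin_le_nhds (this.eventually_le_const (lt_add_one _))
  filter_upwards [hsmall, self_mem_nhdsWithin] with s hs hs0
  have hs0 : 0 < s := hs0
  have h1 := hlip (x + s • h) x hs (by linarith) t
  simp only [add_sub_cancel_left, ContinuousMap.smul_apply, norm_smul,
    intervalIntegral.integral_const_mul, Real.norm_of_nonneg hs0.le] at h1
  rw [Function.comp_apply, ContinuousMap.smul_apply, norm_smul, ContinuousMap.sub_apply, norm_inv,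
    Real.norm_of_nonneg hs0.le, inv_mul_le_iff₀ hs0]
  linarith

/-- The derivative of `x ↦ x + Φ(x)` is everywhere invertible. -/
theorem exists_hasFDerivAt_equiv [CompleteSpace G] (hΦ : IsLocallyVolterra hαβ Φ)
    (hd : Differentiable ℝ Φ) (x : C(Icc α β, G)) :
    ∃ e : C(Icc α β, G) ≃L[ℝ] C(Icc α β, G),
      HasFDerivAt (fun x => x + Φ x) (e : C(Icc α β, G) →L[ℝ] C(Icc α β, G)) x := by
  have hT := (hd x).hasFDerivAt
  obtain ⟨L, hL, h⟩ := hΦ.norm_deriv_apply_le hT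
  have hu : IsUnit (1 - -fderiv ℝ Φ x) :=
    isUnit_one_sub_of_volterra hαβ hL fun k t => by simpa using h k t
  rw [sub_neg_eq_add] at hu
  obtain ⟨u, hu⟩ := hu
  refine ⟨ContinuousLinearEquiv.unitsEquiv ℝ _ u, ?_⟩
  have h2 : ((ContinuousLinearEquiv.unitsEquiv ℝ _ u : C(Icc α β, G) ≃L[ℝ] C(Icc α β, G)) :
      C(Icc α β, G) →L[ℝ] C(Icc α β, G)) = 1 + fderiv ℝ Φ x := by
    rw [← hu]
    rfl
  rw [h2]
  exact (hasFDerivAt_id x).add hT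

/-- `x ↦ x + Φ(x)` is a `C¹` diffeomorphism onto its range, which is open. -/
theorem isOpen_range_and_contDiffAt [CompleteSpace G] (hΦ : IsLocallyVolterra hαβ Φ)
    (hd : ContDiff ℝ 1 Φ) :
    IsOpen (range fun x => x + Φ x) ∧
      ∀ y ∈ range fun x => x + Φ x, ContDiffAt ℝ 1 (Function.invFun fun x => x + Φ x) y := by
  have hcd : ContDiff ℝ 1 fun x => x + Φ x := contDiff_id.add hd
  constructor
  · rw [isOpen_iff_mem_nhds]
    rintro _ ⟨x, rfl⟩
    obtain ⟨e, he⟩ := hΦ.exists_hasFDerivAt_equiv (hd.differentiable one_ne_zero) x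
    have hs := hcd.contDiffAt.hasStrictFDerivAt' he one_ne_zero
    rw [← hs.map_nhds_eq_of_equiv]
    exact range_mem_map
  · rintro _ ⟨x, rfl⟩
    obtain ⟨e, he⟩ := hΦ.exists_hasFDerivAt_equiv (hd.differentiable one_ne_zero) x
    have hs := hcd.contDiffAt.hasStrictFDerivAt' he one_ne_zero
    exact (hcd.contDiffAt.to_localInverse he one_ne_zero).congr_of_eventuallyEq
      (hs.localInverse_unique (Eventually.of_forall (Function.leftInverse_invFun hΦ.injective)))

end IsLocallyVolterra

end Volterra

/-- The integral operator with a kernel that is locally Lipschitz in `x` is of Volterra type. -/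
theorem isLocallyVolterra_volterraIntegral {α β : ℝ} {n : ℕ}
    {v : ℝ → ℝ → EuclideanSpace ℝ (Fin n) → EuclideanSpace ℝ (Fin n)} (hαβ : α ≤ β)
    (hA1 : ConditionA1 α β v) (hA2 : ConditionA2 α β v) :
    IsLocallyVolterra hαβ fun x => AC02.toContinuous n hαβ (volterraIntegral hαβ hA1 hA2 x) := by
  intro ρ
  obtain ⟨L, hL, hLb⟩ := hA2.c.bounded (max ρ 1) (by positivity)
  refine ⟨L, hL.le, fun x y hx hy t => ?_⟩
  have hint : ∀ x : C(Icc α β, EuclideanSpace ℝ (Fin n)), IntervalIntegrable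
      (fun τ => v t τ (x (projIcc α β hαβ τ))) volume α t := fun x =>
    (intervalIntegrable_iff_integrableOn_Icc_of_le t.2.1).2
      (integrableOn_kernel hαβ hA1 hA2 x t.2)
  rw [AC02.toContinuous_apply, AC02.toContinuous_apply, volterraIntegral_apply _ _ _ _ t.2,
    volterraIntegral_apply _ _ _ _ t.2, ← intervalIntegral.integral_sub (hint x) (hint y),
    ← intervalIntegral.integral_const_mul]
  refine intervalIntegral.norm_integral_le_of_norm_le t.2.1 ?_
    ((continuous_norm_comp_projIcc hαβ _).const_mul L).continuousOn.intervalIntegrable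
  have hsub : Ioc α (t : ℝ) ⊆ Icc α β := Ioc_subset_Icc_self.trans (Icc_subset_Icc_right t.2.2)
  rw [← ae_restrict_iff' measurableSet_Ioc]
  filter_upwards [ae_restrict_of_ae_restrict_of_subset hsub hA1.c,
    ae_restrict_of_ae_restrict_of_subset hsub hLb, ae_restrict_mem measurableSet_Ioc]
    with τ hc hb hτ
  have htm : (t : ℝ) ∈ Icc τ β := ⟨hτ.2, t.2.2⟩
  have hball : ∀ x : C(Icc α β, EuclideanSpace ℝ (Fin n)), ‖x‖ ≤ ρ →
      x (projIcc α β hαβ τ) ∈ Metric.closedBall (0 : EuclideanSpace ℝ (Fin n)) (max ρ 1) :=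
    fun x hx => by
      rw [mem_closedBall_zero_iff]
      exact (x.norm_coe_le_norm _).trans (hx.trans (le_max_left _ _))
  exact (convex_closedBall _ _).norm_image_sub_le_of_norm_hasFDerivWithin_le
    (fun z _ => (hc.1 t htm z).hasFDerivAt.hasFDerivWithinAt)
    (fun z hz => hb t htm z (mem_closedBall_zero_iff.1 hz)) (hball y hy) (hball x hx)

/-! ### The a priori bound -/

theorem MeasureTheory.MemLp.eLpNorm_two_eq_sqrt {Ω F : Type*} [MeasurableSpace Ω]
    {ν : Measure Ω} [NormedAddCommGroup F] {f : Ω → F} (hf : MemLp f 2 ν) :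
    eLpNorm f 2 ν = ENNReal.ofReal √(∫ ω, ‖f ω‖ ^ 2 ∂ν) := by
  rw [hf.eLpNorm_eq_integral_rpow_norm (by norm_num) (by norm_num), Real.sqrt_eq_rpow]
  norm_num

section Triangle

variable {α β : ℝ}

theorem restrict_triangle_eq : (volume.restrict (triangle α β) : Measure (ℝ × ℝ))
    = ((volume.restrict (Icc α β)).prod (volume.restrict (Icc α β))).restrict
      {p : ℝ × ℝ | p.2 ≤ p.1} := by
  rw [Measure.prod_restrict, Measure.restrict_restrict
    (measurableSet_le measurable_snd measurable_fst), Measure.volume_eq_prod]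
  congr 1
  ext p
  simp only [triangle, mem_ofPred_eq, mem_inter_iff, mem_prod]
  tauto

theorem measurableSet_snd_le_fst : MeasurableSet {p : ℝ × ℝ | p.2 ≤ p.1} :=
  measurableSet_le measurable_snd measurable_fst

/-- A property of almost every point of the triangle holds for almost every `t` at almost every
`τ ∈ [α, t]`. -/
theorem ae_ae_of_ae_triangle {p : ℝ × ℝ → Prop}
    (h : ∀ᵐ q ∂(volume.restrict (triangle α β)), p q) :
    ∀ᵐ t ∂(volume.restrict (Icc α β)), ∀ᵐ τ ∂(volume.restrict (Icc α t)), p (t, τ) := by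
  rw [restrict_triangle_eq, ae_restrict_iff' measurableSet_snd_le_fst] at h
  filter_upwards [Measure.ae_ae_of_ae_prod h, ae_restrict_mem measurableSet_Icc] with t h1 ht
  filter_upwards [ae_restrict_of_ae_restrict_of_subset (Icc_subset_Icc_right ht.2) h1,
    ae_restrict_mem measurableSet_Icc] with τ h2 hτ
  exact h2 hτ.2

theorem IsL2Triangle.memLp_indicator {c : ℝ × ℝ → ℝ} (hc : IsL2Triangle α β c) :
    MemLp ({p : ℝ × ℝ | p.2 ≤ p.1}.indicator c) 2
      ((volume.restrict (Icc α β)).prod (volume.restrict (Icc α β))) := by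
  rw [memLp_indicator_iff_restrict measurableSet_snd_le_fst, ← restrict_triangle_eq]
  exact hc.2

theorem IsL2Triangle.memLp_slice {c : ℝ × ℝ → ℝ} (hc : IsL2Triangle α β c) :
    ∀ᵐ t ∂(volume.restrict (Icc α β)),
      MemLp (fun τ => c (t, τ)) 2 (volume.restrict (Icc α t)) := by
  have h1 := hc.memLp_indicator.integrable_sq.prod_right_ae
  filter_upwards [h1, hc.memLp_indicator.1.prodMk_left, ae_restrict_mem measurableSet_Icc]
    with t h1 h2 ht
  have h3 : MemLp (fun τ => {p : ℝ × ℝ | p.2 ≤ p.1}.indicator c (t, τ)) 2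
      (volume.restrict (Icc α t)) :=
    ((memLp_two_iff_integrable_sq h2).2 h1).mono_measure
      (Measure.restrict_mono_set _ (Icc_subset_Icc_right ht.2))
  refine (memLp_congr_ae ?_).1 h3
  filter_upwards [ae_restrict_mem measurableSet_Icc] with τ hτ
  exact indicator_of_mem (s := {p : ℝ × ℝ | p.2 ≤ p.1}) hτ.2 c

theorem integral_indicator_sq (c : ℝ × ℝ → ℝ) {t : ℝ} (ht : t ∈ Icc α β) :
    ∫ τ in Icc α β, {p : ℝ × ℝ | p.2 ≤ p.1}.indicator c (t, τ) ^ 2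
      = ∫ τ in α..t, c (t, τ) ^ 2 := by
  rw [intervalIntegral.integral_of_le ht.1, ← integral_Icc_eq_integral_Ioc,
    ← setIntegral_indicator_le ht]
  refine integral_congr_ae (Eventually.of_forall fun τ => ?_)
  by_cases h : τ ≤ t <;> simp [h]

theorem sq_sqrt_integral_sq {c : ℝ × ℝ → ℝ} {t : ℝ} (ht : α ≤ t) :
    √(∫ τ in α..t, c (t, τ) ^ 2) ^ 2 = ∫ τ in α..t, c (t, τ) ^ 2 :=
  Real.sq_sqrt (intervalIntegral.integral_nonneg ht fun _ _ => sq_nonneg _)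

theorem IsL2Triangle.memLp_sqrt_integral {c : ℝ × ℝ → ℝ} (hc : IsL2Triangle α β c) :
    MemLp (fun t => √(∫ τ in α..t, c (t, τ) ^ 2)) 2 (volume.restrict (Icc α β)) := by
  have h1 : Integrable (fun t => ∫ τ in α..t, c (t, τ) ^ 2) (volume.restrict (Icc α β)) := by
    refine hc.memLp_indicator.integrable_sq.integral_prod_left.congr ?_
    filter_upwards [ae_restrict_mem measurableSet_Icc] with t ht using integral_indicator_sq c ht
  rw [memLp_two_iff_integrable_sq (Real.continuous_sqrt.comp_aestronglyMeasurable h1.1)]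
  refine h1.congr ?_
  filter_upwards [ae_restrict_mem measurableSet_Icc] with t ht using (sq_sqrt_integral_sq ht.1).symm

theorem IsL2Triangle.eLpNorm_sqrt_integral {c : ℝ × ℝ → ℝ} (hc : IsL2Triangle α β c) :
    eLpNorm (fun t => √(∫ τ in α..t, c (t, τ) ^ 2)) 2 (volume.restrict (Icc α β))
      = eLpNorm c 2 (volume.restrict (triangle α β)) := by
  rw [hc.memLp_sqrt_integral.eLpNorm_two_eq_sqrt, restrict_triangle_eq,
    ← eLpNorm_indicator_eq_eLpNorm_restrict measurableSet_snd_le_fst,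
    hc.memLp_indicator.eLpNorm_two_eq_sqrt]
  congr 2
  simp only [Real.norm_eq_abs, sq_abs]
  rw [integral_prod _ hc.memLp_indicator.integrable_sq]
  refine setIntegral_congr_fun measurableSet_Icc fun t ht => ?_
  rw [sq_sqrt_integral_sq ht.1, integral_indicator_sq c ht]

end Triangle

section APriori

variable {α β : ℝ} {n : ℕ}
  {v : ℝ → ℝ → EuclideanSpace ℝ (Fin n) → EuclideanSpace ℝ (Fin n)}

/-- Condition (A3) is the case `c₁ = d₁ = 0` of condition (A4). -/
theorem ConditionA3.conditionA4 (hαβ : α < β) (h : ConditionA3 α β v) : ConditionA4 α β v := by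
  obtain ⟨hdiag, c, d, hc, hd, hgrowth, hsmall⟩ := h
  refine ⟨0, 0, c, d, fun _ _ => ⟨le_rfl, le_rfl⟩, MemLp.zero, MemLp.zero, ?_, hc, hd, hgrowth, ?_⟩
  · filter_upwards [ae_restrict_mem measurableSet_Icc] with t ht x
    simp [hdiag t ht x]
  · have hpos : 0 < 1 / √2 * (β - α) := by have := sub_pos.2 hαβ; positivity
    have h1 : (fun t => √(t - α) * (0 : ℝ → ℝ) t + 1 / √2 * (β - α) * √(∫ τ in α..t, c (t, τ) ^ 2))
        = (1 / √2 * (β - α)) • fun t => √(∫ τ in α..t, c (t, τ) ^ 2) := by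
      funext t
      simp
    rw [h1, eLpNorm_const_smul, hc.eLpNorm_sqrt_integral, ← ofReal_norm,
      Real.norm_of_nonneg hpos.le]
    have h2 : (1 / 2 : ℝ) = 1 / √2 * (β - α) * (√2 / (2 * (β - α))) := by
      have := (sub_pos.2 hαβ).ne'
      field_simp
    rw [h2, ENNReal.ofReal_mul hpos.le]
    exact ENNReal.mul_lt_mul_right (by simpa using hpos) ENNReal.ofReal_ne_top hsmall

theorem integral_sub_left_sq {t : ℝ} (ht : α ≤ t) :
    ∫ τ in Icc α t, (τ - α) = (t - α) ^ 2 / 2 := by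
  rw [integral_Icc_eq_integral_Ioc, ← intervalIntegral.integral_of_le ht,
    intervalIntegral.integral_comp_sub_right (fun τ => τ) α, integral_id]
  simp

/-- The pointwise estimate behind the a priori bound: the two terms come from the Cauchy–Schwarz
inequality and from `|x(τ)| ≤ (τ - α)^{1/2} ‖x‖`. -/
theorem norm_integral_vt_le (hαβ : α ≤ β) (x : AC02 α β n) {c d : ℝ × ℝ → ℝ}
    (hc : IsL2Triangle α β c) (hd : IsL2Triangle α β d) {t : ℝ} (ht : t ∈ Icc α β)
    (hct : MemLp (fun τ => c (t, τ)) 2 (volume.restrict (Icc α t)))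
    (hdt : MemLp (fun τ => d (t, τ)) 2 (volume.restrict (Icc α t)))
    (hg : ∀ᵐ τ ∂(volume.restrict (Icc α t)), ∀ y, ‖vt β v t τ y‖ ≤ c (t, τ) * ‖y‖ + d (t, τ)) :
    ‖∫ τ in Icc α t, vt β v t τ (x τ)‖
      ≤ 1 / √2 * (β - α) * √(∫ τ in α..t, c (t, τ) ^ 2) * ‖x‖
        + √(β - α) * √(∫ τ in α..t, d (t, τ) ^ 2) := by
  have htriangle : ∀ τ ∈ Icc α t, (t, τ) ∈ triangle α β := fun τ hτ =>
    ⟨ht, ⟨hτ.1, hτ.2.trans ht.2⟩, hτ.2⟩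
  have hc0 : 0 ≤ᵐ[volume.restrict (Icc α t)] fun τ => c (t, τ) := by
    filter_upwards [ae_restrict_mem measurableSet_Icc] with τ hτ using hc.1 _ (htriangle τ hτ)
  have hd0 : 0 ≤ᵐ[volume.restrict (Icc α t)] fun τ => d (t, τ) := by
    filter_upwards [ae_restrict_mem measurableSet_Icc] with τ hτ using hd.1 _ (htriangle τ hτ)
  have hxc : ContinuousOn (fun τ => ‖x τ‖) (Icc α t) := by
    have h := x.2.absCont.continuousOn
    rw [uIcc_of_le hαβ] at h
    exact (h.mono (Icc_subset_Icc_right ht.2)).norm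
  have hxb : ∀ τ ∈ Icc α t, ‖x τ‖ ≤ √(τ - α) * ‖x‖ := fun τ hτ =>
    AC02.norm_apply_le hαβ x ⟨hτ.1, hτ.2.trans ht.2⟩
  have hxm : MemLp (fun τ => ‖x τ‖) 2 (volume.restrict (Icc α t)) := by
    refine (memLp_two_iff_integrable_sq
      (hxc.aestronglyMeasurable measurableSet_Icc)).2 ?_
    exact (hxc.pow 2).integrableOn_Icc
  have h1 : IntegrableOn (fun τ => c (t, τ) * ‖x τ‖) (Icc α t) := hct.integrable_mul hxm
  have h2 : IntegrableOn (fun τ => d (t, τ)) (Icc α t) := hdt.integrable one_le_two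
  have hle : ‖∫ τ in Icc α t, vt β v t τ (x τ)‖
      ≤ ∫ τ in Icc α t, (c (t, τ) * ‖x τ‖ + d (t, τ)) :=
    norm_integral_le_of_norm_le (h1.add h2) (hg.mono fun τ h => h _)
  rw [integral_add h1 h2] at hle
  have e : ∀ f : ℝ × ℝ → ℝ,
      ∫ τ in α..t, f (t, τ) ^ 2 = ∫ τ in Icc α t, f (t, τ) ^ 2 := fun f => by
    rw [intervalIntegral.integral_of_le ht.1, ← integral_Icc_eq_integral_Ioc]
  have htα : 0 ≤ t - α := sub_nonneg.2 ht.1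
  have hxsq : √(∫ τ in Icc α t, ‖x τ‖ ^ 2) ≤ 1 / √2 * (β - α) * ‖x‖ := by
    have hint : ∫ τ in Icc α t, ‖x τ‖ ^ 2 ≤ ∫ τ in Icc α t, (τ - α) * ‖x‖ ^ 2 := by
      refine setIntegral_mono_on (hxc.pow 2).integrableOn_Icc
        (by fun_prop : Continuous fun τ : ℝ => (τ - α) * ‖x‖ ^ 2).continuousOn.integrableOn_Icc
        measurableSet_Icc fun τ hτ => ?_
      have := pow_le_pow_left₀ (norm_nonneg _) (hxb τ hτ) 2
      rwa [mul_pow, Real.sq_sqrt (sub_nonneg.2 hτ.1)] at this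
    rw [integral_mul_const, integral_sub_left_sq ht.1] at hint
    refine (Real.sqrt_le_sqrt hint).trans ?_
    rw [Real.sqrt_mul (by positivity), Real.sqrt_sq (norm_nonneg _), Real.sqrt_div (sq_nonneg _),
      Real.sqrt_sq htα, div_eq_mul_one_div, mul_comm (t - α)]
    gcongr
    exact ht.2
  have hcs1 := integral_mul_le_sqrt_mul_sqrt hc0
    (Eventually.of_forall fun τ => norm_nonneg (x τ)) hct hxm
  have hcs2 := integral_mul_le_sqrt_mul_sqrt hd0
    (Eventually.of_forall fun _ => zero_le_one) hdt (memLp_const (1 : ℝ))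
  simp only [mul_one, one_pow, integral_const, smul_eq_mul, Measure.real,
    Measure.restrict_apply_univ, Real.volume_Icc, ENNReal.toReal_ofReal htα] at hcs2
  rw [e, e]
  refine hle.trans (add_le_add (hcs1.trans ?_) (hcs2.trans ?_))
  · rw [mul_right_comm, mul_comm]
    gcongr
  · rw [mul_comm]
    gcongr
    exact ht.2

theorem coe_toContinuous_projIcc (hαβ : α ≤ β) (x : AC02 α β n) {t : ℝ} (ht : t ∈ Icc α β) :
    AC02.toContinuous n hαβ x (projIcc α β hαβ t) = x t := by
  rw [projIcc_of_mem hαβ ht, AC02.toContinuous_apply]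

/-- Under (A4), the integral operator grows at most linearly on `AC₀²`, with a rate less
than one. -/
theorem exists_norm_volterraIntegral_le (hαβ : α ≤ β) (hA1 : ConditionA1 α β v)
    (hA2 : ConditionA2 α β v) (hA4 : ConditionA4 α β v) :
    ∃ q < 1, ∃ D : ℝ, ∀ x : AC02 α β n,
      ‖volterraIntegral hαβ hA1 hA2 (AC02.toContinuous n hαβ x)‖ ≤ q * ‖x‖ + D := by
  obtain ⟨c₁, d₁, c₂, d₂, hnonneg, hc₁, hd₁, hdiag, hc₂, hd₂, hgrowth, hsmall⟩ := hA4
  set c : ℝ → ℝ := fun t =>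
    √(t - α) * c₁ t + 1 / √2 * (β - α) * √(∫ τ in α..t, c₂ (t, τ) ^ 2) with hc_def
  let d : ℝ → ℝ := fun t => d₁ t + √(β - α) * √(∫ τ in α..t, d₂ (t, τ) ^ 2)
  have hc : MemLp c 2 (volume.restrict (Icc α β)) := by
    refine ⟨?_, hsmall.trans ENNReal.ofReal_lt_top⟩
    exact ((by fun_prop : Continuous fun t => √(t - α)).aestronglyMeasurable.mul hc₁.1).add
      (hc₂.memLp_sqrt_integral.1.const_mul _)
  have hd : MemLp d 2 (volume.restrict (Icc α β)) :=
    hd₁.add (hd₂.memLp_sqrt_integral.const_mul _)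
  refine ⟨‖hc.toLp‖, ?_, ‖hd.toLp‖, fun x => ?_⟩
  · rw [Lp.norm_toLp]
    refine (ENNReal.toReal_lt_of_lt_ofReal hsmall).trans ?_
    norm_num
  rw [AC02.norm_eq_norm_derivLp]
  have hle : ‖AC02.derivLp (volterraIntegral hαβ hA1 hA2 (AC02.toContinuous n hαβ x))‖
      ≤ ‖‖x‖ • hc.toLp + hd.toLp‖ := by
    refine Lp.norm_le_norm_of_ae_le ?_
    filter_upwards [derivLp_volterraIntegral hαβ hA1 hA2 (AC02.toContinuous n hαβ x),
      Lp.coeFn_add (‖x‖ • hc.toLp) hd.toLp, Lp.coeFn_smul ‖x‖ hc.toLp, hc.coeFn_toLp,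
      hd.coeFn_toLp, hdiag, ae_ae_of_ae_triangle hgrowth, hc₂.memLp_slice, hd₂.memLp_slice,
      ae_restrict_mem measurableSet_Icc] with t h1 h2 h3 h4 h5 h6 h7 h8 h9 ht
    rw [h1, h2, Pi.add_apply, h3, Pi.smul_apply, h4, h5, coe_toContinuous_projIcc hαβ x ht]
    have hvt : ∫ τ in Icc α t, vt β v t τ (AC02.toContinuous n hαβ x (projIcc α β hαβ τ))
        = ∫ τ in Icc α t, vt β v t τ (x τ) :=
      setIntegral_congr_fun measurableSet_Icc fun τ hτ => by
        rw [coe_toContinuous_projIcc hαβ x ⟨hτ.1, hτ.2.trans ht.2⟩]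
    rw [hvt]
    refine (norm_add_le _ _).trans (le_trans ?_ (le_abs_self _))
    have e1 := norm_integral_vt_le hαβ x hc₂ hd₂ ht h8 h9 h7
    have e2 := h6 (x t)
    have e3 := mul_le_mul_of_nonneg_left (AC02.norm_apply_le hαβ x ht) (hnonneg t ht).1
    simp only [hc_def, d, smul_eq_mul]
    linarith
  refine hle.trans ((norm_add_le _ _).trans (le_of_eq ?_))
  rw [norm_smul, norm_norm, mul_comm]

/-- The a priori bound: solutions of `x + K(x) = a` are bounded in terms of `‖a‖`. -/
theorem exists_apriori_bound (hαβ : α ≤ β) (hA1 : ConditionA1 α β v)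
    (hA2 : ConditionA2 α β v) (hA4 : ConditionA4 α β v) (r : ℝ) :
    ∃ ρ : ℝ, ∀ x : AC02 α β n,
      ‖x + volterraIntegral hαβ hA1 hA2 (AC02.toContinuous n hαβ x)‖ ≤ r → ‖x‖ ≤ ρ := by
  obtain ⟨q, hq, D, h⟩ := exists_norm_volterraIntegral_le hαβ hA1 hA2 hA4
  refine ⟨(r + D) / (1 - q), fun x hx => ?_⟩
  rw [le_div_iff₀ (sub_pos.2 hq)]
  have h1 := norm_sub_le (x + volterraIntegral hαβ hA1 hA2 (AC02.toContinuous n hαβ x))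
    (volterraIntegral hαβ hA1 hA2 (AC02.toContinuous n hαβ x))
  rw [add_sub_cancel_right] at h1
  linarith [h x]

end APriori

/-! ### Solvability and the inverse operator -/

section Solution

variable {α β : ℝ} {n : ℕ}
  {v : ℝ → ℝ → EuclideanSpace ℝ (Fin n) → EuclideanSpace ℝ (Fin n)}

/-- The Volterra operator `x ↦ x + ∫_α^t v(t, τ, x(τ)) dτ` on continuous functions. -/
def volterraContinuous (hαβ : α ≤ β) (hA1 : ConditionA1 α β v) (hA2 : ConditionA2 α β v)
    (x : C(Icc α β, EuclideanSpace ℝ (Fin n))) : C(Icc α β, EuclideanSpace ℝ (Fin n)) :=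
  x + AC02.toContinuous n hαβ (volterraIntegral hαβ hA1 hA2 x)

/-- The Volterra operator on `AC₀²`. -/
def volterraOperator (hαβ : α ≤ β) (hA1 : ConditionA1 α β v) (hA2 : ConditionA2 α β v)
    (x : AC02 α β n) : AC02 α β n :=
  x + volterraIntegral hαβ hA1 hA2 (AC02.toContinuous n hαβ x)

/-- The inverse of the Volterra operator on `AC₀²`: the solution `x` of `x + K(x) = a` is
`a - K(y)`, where `y` is the solution in the space of continuous functions. Written in this way, it
takes values in `AC₀²` and is `C¹` into `AC₀²` for any inverse `a ↦ y` that is `C¹` in the uniform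
norm. -/
def volterraSolution (hαβ : α ≤ β) (hA1 : ConditionA1 α β v) (hA2 : ConditionA2 α β v)
    (a : AC02 α β n) : AC02 α β n :=
  a - volterraIntegral hαβ hA1 hA2
    (Function.invFun (volterraContinuous hαβ hA1 hA2) (AC02.toContinuous n hαβ a))

theorem toContinuous_volterraOperator (hαβ : α ≤ β) (hA1 : ConditionA1 α β v)
    (hA2 : ConditionA2 α β v) (x : AC02 α β n) :
    AC02.toContinuous n hαβ (volterraOperator hαβ hA1 hA2 x)
      = volterraContinuous hαβ hA1 hA2 (AC02.toContinuous n hαβ x) := by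
  rw [volterraOperator, map_add, volterraContinuous]

theorem injective_volterraContinuous (hαβ : α ≤ β) (hA1 : ConditionA1 α β v)
    (hA2 : ConditionA2 α β v) : Function.Injective (volterraContinuous hαβ hA1 hA2) :=
  (isLocallyVolterra_volterraIntegral hαβ hA1 hA2).injective

theorem contDiff_toContinuous_volterraIntegral (hαβ : α ≤ β) (hA1 : ConditionA1 α β v)
    (hA2 : ConditionA2 α β v) :
    ContDiff ℝ 1 fun x => AC02.toContinuous n hαβ (volterraIntegral hαβ hA1 hA2 x) :=
  (AC02.toContinuous n hαβ).contDiff.comp (contDiff_volterraIntegral hαβ hA1 hA2)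

theorem contDiff_volterraOperator (hαβ : α ≤ β) (hA1 : ConditionA1 α β v)
    (hA2 : ConditionA2 α β v) : ContDiff ℝ 1 (volterraOperator hαβ hA1 hA2) :=
  contDiff_id.add
    ((contDiff_volterraIntegral hαβ hA1 hA2).comp (AC02.toContinuous n hαβ).contDiff)

theorem toContinuous_sub_volterraIntegral (hαβ : α ≤ β) (hA1 : ConditionA1 α β v)
    (hA2 : ConditionA2 α β v) {a : AC02 α β n} {y : C(Icc α β, EuclideanSpace ℝ (Fin n))}
    (h : volterraContinuous hαβ hA1 hA2 y = AC02.toContinuous n hαβ a) :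
    AC02.toContinuous n hαβ (a - volterraIntegral hαβ hA1 hA2 y) = y := by
  rw [map_sub, ← h, volterraContinuous, add_sub_cancel_right]

/-- A right-hand side in `AC₀²` that is attained on continuous functions is attained on `AC₀²`. -/
theorem volterraOperator_sub_volterraIntegral (hαβ : α ≤ β) (hA1 : ConditionA1 α β v)
    (hA2 : ConditionA2 α β v) {a : AC02 α β n} {y : C(Icc α β, EuclideanSpace ℝ (Fin n))}
    (h : volterraContinuous hαβ hA1 hA2 y = AC02.toContinuous n hαβ a) :
    volterraOperator hαβ hA1 hA2 (a - volterraIntegral hαβ hA1 hA2 y) = a := by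
  rw [volterraOperator, toContinuous_sub_volterraIntegral hαβ hA1 hA2 h, sub_add_cancel]

/-- The set of right-hand sides in `AC₀²` attained on continuous functions is closed: the solutions
for a convergent sequence are bounded by the a priori bound, hence form a Cauchy sequence by the
Lipschitz estimate for the inverse. -/
theorem isClosed_preimage_range (hαβ : α ≤ β) (hA1 : ConditionA1 α β v)
    (hA2 : ConditionA2 α β v) (hA4 : ConditionA4 α β v) :
    IsClosed (AC02.toContinuous n hαβ ⁻¹' range (volterraContinuous hαβ hA1 hA2)) := by
  have hV := isLocallyVolterra_volterraIntegral hαβ hA1 hA2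
  refine IsSeqClosed.isClosed fun a b ha hab => ?_
  choose y hy using ha
  obtain ⟨r, hr⟩ := hab.norm.bddAbove_range
  obtain ⟨ρ, hρ⟩ := exists_apriori_bound hαβ hA1 hA2 hA4 r
  have hyρ : ∀ k, ‖y k‖ ≤ ‖AC02.toContinuous n hαβ‖ * ρ := fun k => by
    have h1 := hρ (a k - volterraIntegral hαβ hA1 hA2 (y k)) (by
      have := volterraOperator_sub_volterraIntegral hαβ hA1 hA2 (hy k)
      rw [volterraOperator] at this
      rw [this]
      exact hr (mem_range_self k))
    rw [← toContinuous_sub_volterraIntegral hαβ hA1 hA2 (hy k)]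
    exact (AC02.toContinuous n hαβ).le_opNorm_of_le h1
  obtain ⟨C, hC0, hC⟩ := hV.exists_antilipschitz (‖AC02.toContinuous n hαβ‖ * ρ)
  have hlim : Tendsto (fun k => volterraContinuous hαβ hA1 hA2 (y k)) atTop
      (𝓝 (AC02.toContinuous n hαβ b)) := by
    simp_rw [hy]
    exact ((AC02.toContinuous n hαβ).continuous.tendsto b).comp hab
  have hcauchy : CauchySeq y := by
    rw [Metric.cauchySeq_iff]
    intro ε hε
    obtain ⟨N, hN⟩ := Metric.cauchySeq_iff.1 hlim.cauchySeq (ε / (C + 1)) (by positivity)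
    refine ⟨N, fun k hk m hm => ?_⟩
    have h1 := hN k hk m hm
    rw [dist_eq_norm] at h1 ⊢
    refine (hC _ _ (hyρ k) (hyρ m)).trans_lt ?_
    change C * ‖volterraContinuous hαβ hA1 hA2 (y k) - volterraContinuous hαβ hA1 hA2 (y m)‖ < ε
    rw [lt_div_iff₀ (by positivity)] at h1
    nlinarith [norm_nonneg
      (volterraContinuous hαβ hA1 hA2 (y k) - volterraContinuous hαβ hA1 hA2 (y m))]
  obtain ⟨y₀, hy₀⟩ := cauchySeq_tendsto_of_complete hcauchy
  have hcont : Continuous (volterraContinuous hαβ hA1 hA2) :=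
    continuous_id.add (contDiff_toContinuous_volterraIntegral hαβ hA1 hA2).continuous
  exact ⟨y₀, tendsto_nhds_unique ((hcont.tendsto y₀).comp hy₀) hlim⟩

/-- Every right-hand side in `AC₀²` is attained: the set of these right-hand sides is open,
closed and nonempty. -/
theorem toContinuous_mem_range (hαβ : α ≤ β) (hA1 : ConditionA1 α β v)
    (hA2 : ConditionA2 α β v) (hA4 : ConditionA4 α β v) (a : AC02 α β n) :
    AC02.toContinuous n hαβ a ∈ range (volterraContinuous hαβ hA1 hA2) := by
  have hopen : IsOpen (range (volterraContinuous hαβ hA1 hA2)) :=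
    ((isLocallyVolterra_volterraIntegral hαβ hA1 hA2).isOpen_range_and_contDiffAt
      (contDiff_toContinuous_volterraIntegral hαβ hA1 hA2)).1
  have hclopen : IsClopen (AC02.toContinuous n hαβ ⁻¹' range (volterraContinuous hαβ hA1 hA2)) :=
    ⟨isClosed_preimage_range hαβ hA1 hA2 hA4,
      hopen.preimage (AC02.toContinuous n hαβ).continuous⟩
  have huniv := hclopen.eq_univ
    ⟨volterraOperator hαβ hA1 hA2 0, _, (toContinuous_volterraOperator hαβ hA1 hA2 0).symm⟩
  exact eq_univ_iff_forall.1 huniv a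

theorem rightInverse_volterraSolution (hαβ : α ≤ β) (hA1 : ConditionA1 α β v)
    (hA2 : ConditionA2 α β v) (hA4 : ConditionA4 α β v) :
    Function.RightInverse (volterraSolution hαβ hA1 hA2) (volterraOperator hαβ hA1 hA2) :=
  fun a => volterraOperator_sub_volterraIntegral hαβ hA1 hA2
    (Function.invFun_eq (toContinuous_mem_range hαβ hA1 hA2 hA4 a))

theorem injective_volterraOperator (hαβ : α ≤ β) (hA1 : ConditionA1 α β v)
    (hA2 : ConditionA2 α β v) : Function.Injective (volterraOperator hαβ hA1 hA2) := by
  intro x y hxy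
  refine AC02.toContinuous_injective hαβ (injective_volterraContinuous hαβ hA1 hA2 ?_)
  rw [← toContinuous_volterraOperator, hxy, toContinuous_volterraOperator]

theorem contDiff_volterraSolution (hαβ : α ≤ β) (hA1 : ConditionA1 α β v)
    (hA2 : ConditionA2 α β v) (hA4 : ConditionA4 α β v) :
    ContDiff ℝ 1 (volterraSolution hαβ hA1 hA2) := by
  have hinv := ((isLocallyVolterra_volterraIntegral hαβ hA1 hA2).isOpen_range_and_contDiffAt
    (contDiff_toContinuous_volterraIntegral hαβ hA1 hA2)).2
  rw [contDiff_iff_contDiffAt]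
  intro a
  refine contDiffAt_id.sub ((contDiff_volterraIntegral hαβ hA1 hA2).contDiffAt.comp a ?_)
  exact (hinv _ (toContinuous_mem_range hαβ hA1 hA2 hA4 a)).comp a
    (AC02.toContinuous n hαβ).contDiff.contDiffAt

theorem integral_toContinuous (hαβ : α ≤ β) (x : AC02 α β n) {t : ℝ} (ht : t ∈ Icc α β) :
    ∫ τ in α..t, v t τ (AC02.toContinuous n hαβ x (projIcc α β hαβ τ))
      = ∫ τ in α..t, v t τ (x τ) := by
  refine intervalIntegral.integral_congr fun τ hτ => ?_
  rw [uIcc_of_le ht.1] at hτ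
  simp only [coe_toContinuous_projIcc hαβ x (Icc_subset_Icc_right ht.2 hτ)]

theorem volterraOperator_apply (hαβ : α ≤ β) (hA1 : ConditionA1 α β v) (hA2 : ConditionA2 α β v)
    (x : AC02 α β n) {t : ℝ} (ht : t ∈ Icc α β) :
    volterraOperator hαβ hA1 hA2 x t = volterra α v x t := by
  rw [volterraOperator, AC02.coe_add, Pi.add_apply, volterraIntegral_apply hαβ hA1 hA2 _ ht,
    integral_toContinuous hαβ x ht, volterra]

end Solution

end

theorem theorem4p2 (α β : ℝ) (hαβ : α < β) (n : ℕ)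
    (v : ℝ → ℝ → EuclideanSpace ℝ (Fin n) → EuclideanSpace ℝ (Fin n))
    (hA1 : ConditionA1 α β v) (hA2 : ConditionA2 α β v)
    (hA34 : ConditionA3 α β v ∨ ConditionA4 α β v) :
    (∀ x : AC02 α β n, ∀ t ∈ Icc α β,
      IntervalIntegrable (fun τ => v t τ (x τ)) volume α t) ∧
    (∃ V : AC02 α β n → AC02 α β n,
      (∀ x, ∀ t ∈ Icc α β, V x t = volterra α v x t) ∧ IsDiffeomorphism V) ∧
    (∀ a : AC02 α β n, ∃! x : AC02 α β n, ∀ t ∈ Icc α β, volterra α v x t = a t) ∧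
    (∃ S : AC02 α β n → AC02 α β n,
      (∀ a, ∀ t ∈ Icc α β, volterra α v (S a) t = a t) ∧ ContDiff ℝ 1 S) := by
  have hA4 : ConditionA4 α β v := hA34.elim (fun h => h.conditionA4 hαβ) id
  have hle := hαβ.le
  have hVx : ∀ x : AC02 α β n, ∀ t ∈ Icc α β,
      volterraOperator hle hA1 hA2 x t = volterra α v x t := fun x t ht =>
    volterraOperator_apply hle hA1 hA2 x ht
  have hright := rightInverse_volterraSolution hle hA1 hA2 hA4
  have hinj := injective_volterraOperator hle hA1 hA2
  have hS := contDiff_volterraSolution hle hA1 hA2 hA4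
  have hsol : ∀ a : AC02 α β n, ∀ t ∈ Icc α β,
      volterra α v (volterraSolution hle hA1 hA2 a) t = a t := fun a t ht => by
    rw [← hVx _ t ht, hright a]
  refine ⟨fun x t ht => ?_, ⟨volterraOperator hle hA1 hA2, hVx, volterraSolution hle hA1 hA2,
    fun x => hinj (hright _), hright,
    (contDiff_volterraOperator hle hA1 hA2).differentiable one_ne_zero,
    hS.differentiable one_ne_zero⟩, fun a => ⟨_, hsol a, fun x hx => ?_⟩, ⟨_, hsol, hS⟩⟩
  · rw [intervalIntegrable_iff_integrableOn_Icc_of_le ht.1]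
    refine (integrableOn_kernel hle hA1 hA2 (AC02.toContinuous n hle x) ht).congr_fun
      (fun τ hτ => ?_) measurableSet_Icc
    simp only [coe_toContinuous_projIcc hle x (Icc_subset_Icc_right ht.2 hτ)]
  · refine hinj (AC02.ext_of_forall fun t ht => ?_)
    rw [hVx x t ht, hx t ht, hright a]
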